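/- **Setting.** Let $k$ be a field, $H$ a Hopf algebra over $k$ with comultiplication $\Delta h=h_{(1)}\otimes h_{(2)}$, counit $\varepsilon$ and antipode $S$, and let $P$ be a unital right $H$-comodule algebra with coaction $\Delta_R p=p_{(0)}\otimes p_{(1)}$ and algebra of coinvariants $B=\{b\in P:\Delta_R b=b\otimes 1\}$. Unadorned tensor products are over $k$. Assume that $B\subseteq P$ is an $H$-Galois extension, i.e. that $\chi:P\otimes_BP\to P\otimes H$, $p\otimes_B q\mapsto pq_{(0)}\otimes q_{(1)}$, is bijective, and write $\tau(h)=\chi^{-1}(1\otimes h)=h^{[1]}\otimes_B h^{[2]}$. Let $\Omega^1P=\ker(m:P\otimes P\to P)$, $\mathrm dp=1\otimes p-p\otimes 1$, and $(\Omega^1B)P=\ker(m:B\otimes P\to P)\subseteq\Omega^1P$. The space $\Omega^1P$ carries the restriction $\Delta_\Omega$ of the diagonal coaction $p\otimes q\mapsto p_{(0)}\otimes q_{(0)}\otimes p_{(1)}q_{(1)}$; $B\otimes P$ and $(\Omega^1B)P$ carry $b\otimes p\mapsto b\otimes p_{(0)}\otimes p_{(1)}$; and $\mathrm{ad}(h)=h_{(2)}\otimes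 S(h_{(1)})h_{(3)}$. Consider the following four sets of $k$-linear maps. 1. $V_1$: unital left $B$-linear right $H$-colinear maps $s:P\to B\otimes P$ with $m\circ s=\mathrm{id}$. 2. $V_2$: right $H$-colinear maps $D:P\to(\Omega^1B)P$ with $D(1)=0$ and $D(bp)=b\,D(p)+\mathrm db\cdot p$ for all $b\in B$, $p\in P$. 3. $V_3$: left $P$-linear right $H$-colinear maps $\Pi:\Omega^1P\to\Omega^1P$ with $\Pi^2=\Pi$ and $(\mathrm{id}-\Pi)(B\,\mathrm dP)=(\Omega^1B)P$. 4. $V_4$: maps $\omega:H\to\Omega^1P$ with $\omega(1)=0$, $\Delta_\Omega\circ\omega=(\omega\otimes\mathrm{id})\circ\mathrm{ad}$, $(m\otimes\mathrm{id})\circ(\mathrm{id}\otimes\Delta_R)\circ\omega=1\otimes(\mathrm{id}-\varepsilon)$, and $\mathrm dp-p_{(0)}\omega(p_{(1)})\in(\Omega^1B)P$ for all $p\in P$. These are the four descriptions of a strong connection. They are identified by the bijections $J_1:V_1\to V_2$, $J_2:V_2\to V_3$, $J_3:V_3\to V_4$, $J_4:V_4\to V_1$ given by $$J_1(s)(p)=1\otimes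 p-s(p),\quad J_2(D)(r\,\mathrm dp)=r(\mathrm dp-Dp),\quad J_3(\Pi)(h)=h^{[1]}\Pi(\mathrm dh^{[2]}),\quad J_4(\omega)(p)=p\otimes1+p_{(0)}\omega(p_{(1)}),$$ whose cyclic composites are identities. A gauge transformation is a unital convolution-invertible linear map $f:H\to P$ with $\Delta_R\circ f=(f\otimes\mathrm{id})\circ\mathrm{ad}$; $f^{-1}$ denotes its convolution inverse. **Theorem.** Assume that $B\subseteq P$ admits a strong connection. The gauge transformations form a group under convolution $(f*g)(h)=f(h_{(1)})g(h_{(2)})$, and the formulas 1. $(f\triangleright s)(p)=s\big(p_{(0)}f(p_{(1)})\big)f^{-1}(p_{(2)})$, 2. $(f\triangleright D)(p)=D\big(p_{(0)}f(p_{(1)})\big)f^{-1}(p_{(2)})$, 3. $(f\triangleright\Pi)(r\,\mathrm dp)=r\,\Pi\big(\mathrm d(p_{(0)}f(p_{(1)}))\big)f^{-1}(p_{(2)})+r\,p_{(0)}f(p_{(1)})\,\mathrm df^{-1}(p_{(2)})$, 4. $(f\triangleright\omega)(h)=f(h_{(1)})\,\omega(h_{(2)})\,f^{-1}(h_{(3)})+f(h_{(1)})\,\mathrm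 df^{-1}(h_{(2)})$ define left actions of this group on $V_1,V_2,V_3,V_4$, respectively. These actions are compatible with the identifications: $J_i(f\triangleright x)=f\triangleright J_i(x)$ for all $i\in\{1,2,3,4\}$, every gauge transformation $f$ and every $x\in V_i$; hence the same holds for all composites of the $J_i$. -/

import Mathlib

open scoped TensorProduct

noncomputable section

namespace HopfGalois

variable {k H P : Type*} [Field k] [Ring H] [HopfAlgebra k H] [Ring P] [Algebra k P]

/-! ### Comodule algebras, coinvariants and the canonical map -/

/-- `δ` is a right coaction: `(δ ⊗ id) ∘ δ = (id ⊗ Δ) ∘ δ` and `(id ⊗ ε) ∘ δ = id`.  Since `δ` is an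
algebra homomorphism, this makes `P` a right `H`-comodule algebra.  Sweedler notation below:
`δ p = p₍₀₎ ⊗ p₍₁₎`. -/
structure IsCoaction (δ : P →ₐ[k] P ⊗[k] H) : Prop where
  coassoc : (TensorProduct.assoc k P H H).toLinearMap ∘ₗ δ.toLinearMap.rTensor H ∘ₗ δ.toLinearMap =
    (Coalgebra.comul (R := k) (A := H)).lTensor P ∘ₗ δ.toLinearMap
  counit : (TensorProduct.rid k P).toLinearMap ∘ₗ
    (Coalgebra.counit (R := k) (A := H)).lTensor P ∘ₗ δ.toLinearMap = LinearMap.id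

/-- The algebra `B = {b | δ b = b ⊗ 1}` of coinvariants. -/
abbrev coinv (δ : P →ₐ[k] P ⊗[k] H) : Subalgebra k P :=
  AlgHom.equalizer δ Algebra.TensorProduct.includeLeft

/-- The left action `P ⊗ M → M`, `p ⊗ x ↦ p x`, of `P` on a left `P`-module. -/
def actL (k P M : Type*) [Field k] [Ring P] [Algebra k P] [AddCommGroup M] [Module k M] [Module P M]
    [IsScalarTower k P M] : P ⊗[k] M →ₗ[k] M :=
  TensorProduct.lift (Algebra.lsmul k k M).toLinearMap

/-- The right action `(M ⊗ P) ⊗ P → M ⊗ P`, `(x ⊗ p) ⊗ q ↦ x ⊗ p q`. -/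
def actR (k P M : Type*) [Field k] [Ring P] [Algebra k P] [AddCommGroup M] [Module k M] :
    (M ⊗[k] P) ⊗[k] P →ₗ[k] M ⊗[k] P :=
  (LinearMap.mul' k P).lTensor M ∘ₗ (TensorProduct.assoc k M P P).toLinearMap

/-- The map `P ⊗ P → P ⊗ H`, `p ⊗ q ↦ p q₍₀₎ ⊗ q₍₁₎`. -/
def preCan (δ : P →ₐ[k] P ⊗[k] H) : P ⊗[k] P →ₗ[k] P ⊗[k] H :=
  (LinearMap.mul' k P).rTensor H ∘ₗ (TensorProduct.assoc k P P H).symm.toLinearMap ∘ₗ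
    δ.toLinearMap.lTensor P

/-- The subspace of `P ⊗ P` spanned by the elements `p b ⊗ q - p ⊗ b q` with `b ∈ B`. -/
def balancing (δ : P →ₐ[k] P ⊗[k] H) : Submodule k (P ⊗[k] P) :=
  Submodule.span k {x | ∃ (p q : P) (b : coinv δ), x = (p * b) ⊗ₜ[k] q - p ⊗ₜ[k] (b * q)}

/-- The tensor product `P ⊗_B P` over the (noncommutative) algebra of coinvariants. -/
abbrev BalancedTensor (δ : P →ₐ[k] P ⊗[k] H) : Type _ := (P ⊗[k] P) ⧸ balancing δ

lemma coe_mul_tmul (a b : P) (t : P ⊗[k] H) :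
    (LinearMap.mul' k P).rTensor H ((TensorProduct.assoc k P P H).symm ((a * b) ⊗ₜ t)) =
    (LinearMap.mul' k P).rTensor H ((TensorProduct.assoc k P P H).symm
      (a ⊗ₜ ((b ⊗ₜ[k] (1 : H)) * t))) := by
  induction t with
  | zero => simp
  | add x y hx hy => simp only [TensorProduct.tmul_add, mul_add, map_add, hx, hy]
  | tmul x y => simp [mul_assoc]

lemma balancing_le_ker (δ : P →ₐ[k] P ⊗[k] H) : balancing δ ≤ LinearMap.ker (preCan δ) := by
  refine Submodule.span_le.2 ?_
  rintro x ⟨p, q, b, rfl⟩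
  have hb : δ (b : P) = (b : P) ⊗ₜ[k] (1 : H) := b.2
  simp only [SetLike.mem_coe, LinearMap.mem_ker, map_sub, sub_eq_zero]
  simp [preCan, coe_mul_tmul, hb]

/-- The canonical map `χ : P ⊗_B P → P ⊗ H`, `p ⊗_B q ↦ p q₍₀₎ ⊗ q₍₁₎`. -/
def can (δ : P →ₐ[k] P ⊗[k] H) : BalancedTensor δ →ₗ[k] P ⊗[k] H :=
  (balancing δ).liftQ (preCan δ) (balancing_le_ker δ)

/-- `B ⊆ P` is an `H`-Galois extension: `P` is a right `H`-comodule algebra, `B` is its algebra of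
coinvariants, and the canonical map is bijective. -/
structure IsHopfGalois (δ : P →ₐ[k] P ⊗[k] H) : Prop extends IsCoaction δ where
  bijective_can : Function.Bijective (can δ)

/-- The translation map `τ(h) = χ⁻¹(1 ⊗ h)`. -/
def translation {δ : P →ₐ[k] P ⊗[k] H} (hδ : IsHopfGalois δ) (h : H) : BalancedTensor δ :=
  (LinearEquiv.ofBijective (can δ) hδ.bijective_can).symm (1 ⊗ₜ[k] h)

/-! ### The universal differential calculus -/

/-- `Ω¹P`, the kernel of the multiplication map `P ⊗ P → P`, as a left `P`-submodule. -/
def Omega (k P : Type*) [Field k] [Ring P] [Algebra k P] : Submodule P (P ⊗[k] P) where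
  carrier := {x | LinearMap.mul' k P x = 0}
  add_mem' := by
    intro x y hx hy
    simp_all
  zero_mem' := by simp
  smul_mem' := by
    intro r x hx
    have key : ∀ y : P ⊗[k] P, LinearMap.mul' k P (r • y) = r * LinearMap.mul' k P y := by
      intro y
      induction y with
      | zero => simp
      | add a b ha hb => simp only [smul_add, map_add, mul_add, ha, hb]
      | tmul a b => simp [TensorProduct.smul_tmul', mul_assoc]
    simp only [Set.mem_ofPred_eq] at hx ⊢
    rw [key, hx, mul_zero]

/-- The inclusion `Ω¹P ⊆ P ⊗ P`. -/
def Omega.incl (k P : Type*) [Field k] [Ring P] [Algebra k P] : Omega k P →ₗ[k] P ⊗[k] P :=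
  (Omega k P).subtype.restrictScalars k

/-- The projection `P ⊗ P → Ω¹P`, `r ⊗ p ↦ r dp = r ⊗ p - r p ⊗ 1`. -/
def Omega.proj (k P : Type*) [Field k] [Ring P] [Algebra k P] : P ⊗[k] P →ₗ[k] Omega k P where
  toFun x := ⟨x - LinearMap.mul' k P x ⊗ₜ[k] 1, by
    change LinearMap.mul' k P _ = 0
    simp⟩
  map_add' x y := by
    ext
    simp [TensorProduct.add_tmul, add_sub_add_comm]
  map_smul' c x := by
    ext
    simp [TensorProduct.smul_tmul', smul_sub]

/-- The universal differential `dp = 1 ⊗ p - p ⊗ 1`. -/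
def d (k : Type*) {P : Type*} [Field k] [Ring P] [Algebra k P] : P →ₗ[k] Omega k P :=
  Omega.proj k P ∘ₗ TensorProduct.mk k P P 1

lemma coe_d (p : P) : (d k p : P ⊗[k] P) = 1 ⊗ₜ[k] p - p ⊗ₜ[k] 1 := by
  simp [d, Omega.proj]

/-- The diagonal coaction `p ⊗ q ↦ p₍₀₎ ⊗ q₍₀₎ ⊗ p₍₁₎ q₍₁₎` on `P ⊗ P`. -/
def diagCoaction (δ : P →ₐ[k] P ⊗[k] H) : P ⊗[k] P →ₗ[k] (P ⊗[k] P) ⊗[k] H :=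
  (LinearMap.mul' k H).lTensor (P ⊗[k] P) ∘ₗ
    (TensorProduct.tensorTensorTensorComm k P H P H).toLinearMap ∘ₗ
    TensorProduct.map δ.toLinearMap δ.toLinearMap

/-- The restriction of the diagonal coaction to `Ω¹P → Ω¹P ⊗ H`
(that it is this restriction is `incl_omegaCoaction`). -/
def omegaCoaction (δ : P →ₐ[k] P ⊗[k] H) : Omega k P →ₗ[k] Omega k P ⊗[k] H :=
  (Omega.proj k P).rTensor H ∘ₗ diagCoaction δ ∘ₗ Omega.incl k P

lemma mul_diagCoaction (δ : P →ₐ[k] P ⊗[k] H) (x : P ⊗[k] P) :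
    (LinearMap.mul' k P).rTensor H (diagCoaction δ x) = δ (LinearMap.mul' k P x) := by
  have key : ∀ s t : P ⊗[k] H, (LinearMap.mul' k P).rTensor H
      ((LinearMap.mul' k H).lTensor (P ⊗[k] P)
        (TensorProduct.tensorTensorTensorComm k P H P H (s ⊗ₜ t))) = s * t := by
    intro s t
    induction s with
    | zero => simp
    | add a b ha hb => simp only [TensorProduct.add_tmul, map_add, add_mul, ha, hb]
    | tmul a b =>
      induction t with
      | zero => simp
      | add a b ha hb => simp only [TensorProduct.tmul_add, map_add, mul_add, ha, hb]
      | tmul c e => simp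
  induction x with
  | zero => simp
  | add a b ha hb => simp only [map_add, ha, hb]
  | tmul p q => simp [diagCoaction, key]

lemma incl_omegaCoaction (δ : P →ₐ[k] P ⊗[k] H) (x : Omega k P) :
    (Omega.incl k P).rTensor H (omegaCoaction δ x) = diagCoaction δ (x : P ⊗[k] P) := by
  have key : Omega.incl k P ∘ₗ Omega.proj k P =
      LinearMap.id - (TensorProduct.mk k P P).flip 1 ∘ₗ LinearMap.mul' k P := rfl
  have hx : LinearMap.mul' k P (x : P ⊗[k] P) = 0 := x.2
  simp only [omegaCoaction, LinearMap.comp_apply]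
  rw [← LinearMap.comp_apply, ← LinearMap.rTensor_comp, key, LinearMap.rTensor_sub,
    LinearMap.rTensor_comp]
  simp only [LinearMap.sub_apply, LinearMap.comp_apply, mul_diagCoaction]
  simp [Omega.incl, hx]

/-- The multiplication map `B ⊗ P → P`. -/
def mulB (δ : P →ₐ[k] P ⊗[k] H) : coinv δ ⊗[k] P →ₗ[k] P := actL k (coinv δ) P

/-- The inclusion `B ⊗ P → P ⊗ P`. -/
def inclB (δ : P →ₐ[k] P ⊗[k] H) : coinv δ ⊗[k] P →ₗ[k] P ⊗[k] P :=
  (coinv δ).val.toLinearMap.rTensor P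

/-- `(Ω¹B)P`, the kernel of the multiplication map `B ⊗ P → P`. -/
def OmegaB (δ : P →ₐ[k] P ⊗[k] H) : Submodule k (coinv δ ⊗[k] P) := LinearMap.ker (mulB δ)

/-- `(Ω¹B)P` as a subspace of `P ⊗ P`. -/
def OmegaBP (δ : P →ₐ[k] P ⊗[k] H) : Submodule k (P ⊗[k] P) := (OmegaB δ).map (inclB δ)

/-- `B dP`, the span of the forms `b dp`, as a subspace of `Ω¹P`. -/
def BdP (δ : P →ₐ[k] P ⊗[k] H) : Submodule k (Omega k P) :=
  Submodule.span k {x | ∃ (b : coinv δ) (p : P), x = (b : P) • d k p}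

/-- The coaction `b ⊗ p ↦ b ⊗ p₍₀₎ ⊗ p₍₁₎` on `B ⊗ P`. -/
def coactionB (δ : P →ₐ[k] P ⊗[k] H) : coinv δ ⊗[k] P →ₗ[k] (coinv δ ⊗[k] P) ⊗[k] H :=
  (TensorProduct.assoc k (coinv δ) P H).symm.toLinearMap ∘ₗ δ.toLinearMap.lTensor (coinv δ)

/-- The right adjoint coaction `h ↦ h₍₂₎ ⊗ S(h₍₁₎) h₍₃₎`. -/
def adCoaction (k H : Type*) [Field k] [Ring H] [HopfAlgebra k H] : H →ₗ[k] H ⊗[k] H :=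
  (LinearMap.mul' k H ∘ₗ (HopfAlgebra.antipode k (A := H)).rTensor H).lTensor H ∘ₗ
    (TensorProduct.leftComm k H H H).toLinearMap ∘ₗ
    (Coalgebra.comul (R := k) (A := H)).lTensor H ∘ₗ Coalgebra.comul

/-! ### The four descriptions of a strong connection -/

/-- For `T : H → M` with values in a left `P`-module, the map `P → M`, `p ↦ p₍₀₎ T(p₍₁₎)`. -/
def coactL (δ : P →ₐ[k] P ⊗[k] H) {M : Type*} [AddCommGroup M] [Module k M] [Module P M]
    [IsScalarTower k P M] (T : H →ₗ[k] M) : P →ₗ[k] M :=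
  actL k P M ∘ₗ T.lTensor P ∘ₗ δ.toLinearMap

/-- Unital left `B`-linear right `H`-colinear splittings `s` of the multiplication `B ⊗ P → P`. -/
@[ext]
structure StrongSplitting (δ : P →ₐ[k] P ⊗[k] H) where
  toMap : P →ₗ[coinv δ] coinv δ ⊗[k] P
  map_one : toMap 1 = 1 ⊗ₜ 1
  splits : ∀ p, mulB δ (toMap p) = p
  colinear : coactionB δ ∘ₗ toMap.restrictScalars k =
    (toMap.restrictScalars k).rTensor H ∘ₗ δ.toLinearMap

/-- Right `H`-colinear maps `D : P → (Ω¹B)P` with `D 1 = 0` and the Leibniz rule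
`D(b p) = b D p + db.p`, where `db.p = 1 ⊗ b p - b ⊗ p`. -/
@[ext]
structure CovariantDifferential (δ : P →ₐ[k] P ⊗[k] H) where
  toMap : P →ₗ[k] coinv δ ⊗[k] P
  mem : ∀ p, toMap p ∈ OmegaB δ
  map_one : toMap 1 = 0
  leibniz : ∀ (b : coinv δ) (p : P),
    toMap (b * p) = b • toMap p + (1 ⊗ₜ[k] ((b : P) * p) - b ⊗ₜ[k] p)
  colinear : coactionB δ ∘ₗ toMap = toMap.rTensor H ∘ₗ δ.toLinearMap

/-- Left `P`-linear right `H`-colinear projections `Π` on `Ω¹P` with `(id - Π)(B dP) = (Ω¹B)P`. -/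
@[ext]
structure StrongConnection (δ : P →ₐ[k] P ⊗[k] H) where
  toMap : Omega k P →ₗ[P] Omega k P
  idem : ∀ x, toMap (toMap x) = toMap x
  colinear : omegaCoaction δ ∘ₗ toMap.restrictScalars k =
    (toMap.restrictScalars k).rTensor H ∘ₗ omegaCoaction δ
  strong : (BdP δ).map (Omega.incl k P ∘ₗ (LinearMap.id - toMap.restrictScalars k)) = OmegaBP δ

/-- Strong connection forms `ω : H → Ω¹P`. -/
@[ext]
structure StrongConnectionForm (δ : P →ₐ[k] P ⊗[k] H) where
  toMap : H →ₗ[k] Omega k P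
  map_one : toMap 1 = 0
  colinear : omegaCoaction δ ∘ₗ toMap = toMap.rTensor H ∘ₗ adCoaction k H
  vertical : ∀ h, preCan δ (toMap h : P ⊗[k] P) =
    1 ⊗ₜ[k] (h - algebraMap k H (Coalgebra.counit h))
  strong : ∀ p, (d k p - coactL δ toMap p : P ⊗[k] P) ∈ OmegaBP δ

/-! ### Gauge transformations -/

/-- A gauge transformation: a convolution-invertible linear map `f : H → P` that is unital and
satisfies `δ ∘ f = (f ⊗ id) ∘ ad`.  The ring structure on `WithConv (H →ₗ[k] P)` is convolution. -/
structure IsGauge (δ : P →ₐ[k] P ⊗[k] H) (f : (WithConv (H →ₗ[k] P))ˣ) : Prop where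
  map_one : f.val.ofConv 1 = 1
  colinear : δ.toLinearMap ∘ₗ f.val.ofConv = f.val.ofConv.rTensor H ∘ₗ adCoaction k H

variable (δ : P →ₐ[k] P ⊗[k] H) (f : (WithConv (H →ₗ[k] P))ˣ)

/-- For `T : P → M ⊗ P`, the map `p ↦ T(p₍₀₎ f(p₍₁₎)) f⁻¹(p₍₂₎)`. -/
def gaugeTwist {M : Type*} [AddCommGroup M] [Module k M] (T : P →ₗ[k] M ⊗[k] P) :
    P →ₗ[k] M ⊗[k] P :=
  actR k P M ∘ₗ TensorProduct.map (T ∘ₗ coactL δ f.val.ofConv) f.inv.ofConv ∘ₗ δ.toLinearMap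

/-- The map `p ↦ Π(d(p₍₀₎ f(p₍₁₎))) f⁻¹(p₍₂₎) + p₍₀₎ f(p₍₁₎) d f⁻¹(p₍₂₎)`. -/
def gaugeConnection (Q : Omega k P →ₗ[P] Omega k P) : P →ₗ[k] P ⊗[k] P :=
  gaugeTwist δ f (Omega.incl k P ∘ₗ Q.restrictScalars k ∘ₗ d k) +
    actL k P (P ⊗[k] P) ∘ₗ
      TensorProduct.map (coactL δ f.val.ofConv) (Omega.incl k P ∘ₗ d k ∘ₗ f.inv.ofConv) ∘ₗ
      δ.toLinearMap

/-- The map `h ↦ f(h₍₁₎) ω(h₍₂₎) f⁻¹(h₍₃₎) + f(h₍₁₎) d f⁻¹(h₍₂₎)`. -/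
def gaugeForm (w : H →ₗ[k] Omega k P) : H →ₗ[k] P ⊗[k] P :=
  actL k P (P ⊗[k] P) ∘ₗ
      TensorProduct.map f.val.ofConv
        (actR k P P ∘ₗ TensorProduct.map (Omega.incl k P ∘ₗ w) f.inv.ofConv ∘ₗ
          Coalgebra.comul) ∘ₗ
      Coalgebra.comul +
    actL k P (P ⊗[k] P) ∘ₗ
      TensorProduct.map f.val.ofConv (Omega.incl k P ∘ₗ d k ∘ₗ f.inv.ofConv) ∘ₗ
      Coalgebra.comul

end HopfGalois

end

/-! For an algebra `A`, the product `(N * T)(p) = N(p₍₀₎) T(p₍₁₎)` makes linear maps `P → A` a right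
module over the convolution algebra of maps `H → A` (`coactMul_coactMul`, `coactMul_one`).
Everything is computed in this module. Let `j(h) = 1 ⊗ h`, a convolution unit with inverse `1 ⊗
S(h)`. Then `(N ⊗ id) ∘ δ = (N ⊗ 1) * j`, and `(T ⊗ id) ∘ ad = j⁻¹ * (T ⊗ 1) * j`. Hence `f` is
`ad`-colinear iff `j * (δ ∘ f) = (f ⊗ 1) * j`. This relation is stable under products and inverses,
which gives the group, and it makes `F_f = id * f` a colinear endomorphism of `P`.

The transform of `T` is `(T ∘ F_f) * (1 ⊗ f⁻¹)`. Both `F_g ∘ F_f = F_{f*g}` and `(f*g)⁻¹ = g⁻¹ *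
f⁻¹` reverse the order, so it is a left action (`gaugeTwist_mul`). The transform fixes `p ↦ 1 ⊗ p`,
so splittings and differentials transform by the same formula. It does not fix `p ↦ p ⊗ 1`, and the
defect is the inhomogeneous term `f df⁻¹` for connections and forms
(`gaugeConnection_toConnection`).

The Galois condition enters through forms: since `P ⊗_B P ≅ P ⊗ H`, left `B`-linear maps on `P` are
exactly the maps `p ↦ p₍₀₎ T(p₍₁₎)`, for a unique `T` on `H` (`IsHopfGalois.exists_coactL_eq`,
`IsHopfGalois.coactL_injective`). A connection and its form are thus related by `p₍₀₎ ω(p₍₁₎) =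
Π(dp)`, which transports every statement about `ω` to `P`.

The axioms of a gauge transform are verified only for splittings. The other three actions are
transported along the bijections, so what remains is to identify the transported actions with the
stated formulas. -/

noncomputable section

namespace HopfGalois

open WithConv

variable {k H P A A' : Type*} [Field k] [Ring H] [HopfAlgebra k H] [Ring P] [Algebra k P]
  [Ring A] [Algebra k A] [Ring A'] [Algebra k A']

/-! ### Convolution calculus -/

/-- Composition with an algebra homomorphism, as a homomorphism of convolution algebras. -/
def convMap (H : Type*) [Ring H] [HopfAlgebra k H] (i : A →ₐ[k] A') :
    WithConv (H →ₗ[k] A) →+* WithConv (H →ₗ[k] A') where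
  toFun T := toConv (i.toLinearMap ∘ₗ T.ofConv)
  map_one' := by ext; simp [LinearMap.convOne_def]
  map_mul' T U := by
    rw [LinearMap.algHom_comp_convMul_distrib]
  map_zero' := by ext; simp
  map_add' T U := by ext; simp

@[simp] lemma ofConv_convMap (i : A →ₐ[k] A') (T : WithConv (H →ₗ[k] A)) :
    (convMap H i T).ofConv = i.toLinearMap ∘ₗ T.ofConv := rfl

/-- The inclusion `h ↦ 1 ⊗ h` as a unit of the convolution algebra of maps `H → A ⊗ H`. -/
def convIncl (k H A : Type*) [Field k] [Ring H] [HopfAlgebra k H] [Ring A] [Algebra k A] :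
    (WithConv (H →ₗ[k] A ⊗[k] H))ˣ :=
  Units.map (convMap H (Algebra.TensorProduct.includeRight : H →ₐ[k] A ⊗[k] H)).toMonoidHom
    ⟨toConv LinearMap.id, toConv (HopfAlgebra.antipode k), LinearMap.id_mul_antipode,
      LinearMap.antipode_mul_id⟩

lemma convMap_convIncl (i : A →ₐ[k] A') :
    convMap H (Algebra.TensorProduct.map i (AlgHom.id k H)) (convIncl k H A).val =
      (convIncl k H A').val := by
  ext h
  change (Algebra.TensorProduct.map i (AlgHom.id k H)) (1 ⊗ₜ h) = 1 ⊗ₜ[k] h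
  simp

/-- The inclusion `a ↦ a ⊗ 1`. -/
abbrev inclLeft (k H A : Type*) [Field k] [Ring H] [Algebra k H] [Ring A] [Algebra k A] :
    A →ₐ[k] A ⊗[k] H := Algebra.TensorProduct.includeLeft

/-- The factorisation `a ⊗ h = (a ⊗ 1)(1 ⊗ h)` turns tensoring with `H` into a convolution product.
-/
lemma rTensor_comul (T : WithConv (H →ₗ[k] A)) :
    toConv (T.ofConv.rTensor H ∘ₗ Coalgebra.comul) =
      convMap H (inclLeft k H A) T * (convIncl k H A).val := by
  apply ofConv_injective
  simp only [LinearMap.convMul_def, ofConv_convMap]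
  rw [← LinearMap.comp_assoc]
  congr 1
  ext a b
  change T a ⊗ₜ[k] b = (T a ⊗ₜ[k] 1) * (1 ⊗ₜ[k] b)
  simp

/-- In `H ⊗ H` one has `ad(h) = (1 ⊗ S(h₍₁₎)) (h₍₂₎ ⊗ h₍₃₎)`. -/
lemma adCoaction_eq : toConv (adCoaction k H) = (convIncl k H H).inv * toConv Coalgebra.comul := by
  apply ofConv_injective
  simp only [LinearMap.convMul_def, adCoaction]
  have : ((LinearMap.mul' k H ∘ₗ (HopfAlgebra.antipode k (A := H)).rTensor H).lTensor H ∘ₗ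
    (TensorProduct.leftComm k H H H).toLinearMap) =
      LinearMap.mul' k (H ⊗[k] H) ∘ₗ TensorProduct.map (convIncl k H H).inv.ofConv LinearMap.id := by
    ext a b c
    change b ⊗ₜ[k] (HopfAlgebra.antipode k a * c) =
      (1 ⊗ₜ[k] (HopfAlgebra.antipode k a)) * (b ⊗ₜ[k] c)
    simp
  rw [← LinearMap.comp_assoc, this, LinearMap.comp_assoc]
  congr 1
  rw [← LinearMap.comp_assoc]
  congr 1
  ext a b
  simp

/-- `T` need not be multiplicative, but `T ⊗ id` commutes with left multiplication by `1 ⊗ S(h)`.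
This factor therefore passes outside and `rTensor_comul` handles the rest. -/
lemma rTensor_adCoaction (T : WithConv (H →ₗ[k] A)) :
    toConv (T.ofConv.rTensor H ∘ₗ adCoaction k H) =
      (convIncl k H A).inv * (convMap H (inclLeft k H A) T * (convIncl k H A).val) := by
  rw [← rTensor_comul]
  apply ofConv_injective
  rw [← ofConv_toConv (adCoaction k H), adCoaction_eq]
  simp only [LinearMap.convMul_def]
  have : T.ofConv.rTensor H ∘ₗ LinearMap.mul' k (H ⊗[k] H) ∘ₗ
        TensorProduct.map (convIncl k H H).inv.ofConv LinearMap.id =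
      LinearMap.mul' k (A ⊗[k] H) ∘ₗ TensorProduct.map (convIncl k H A).inv.ofConv
        (T.ofConv.rTensor H) := by
    ext a b c
    change T.ofConv.rTensor H ((1 ⊗ₜ[k] (HopfAlgebra.antipode k a)) * (b ⊗ₜ[k] c)) =
      (1 ⊗ₜ[k] (HopfAlgebra.antipode k a)) * (T.ofConv b ⊗ₜ[k] c)
    simp
  have e1 : TensorProduct.map (convIncl k H H).inv.ofConv (Coalgebra.comul (R := k) (A := H)) =
      TensorProduct.map (convIncl k H H).inv.ofConv LinearMap.id ∘ₗ
        (Coalgebra.comul (R := k) (A := H)).lTensor H := by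
    ext; simp
  have e2 : TensorProduct.map (convIncl k H A).inv.ofConv
        (T.ofConv.rTensor H ∘ₗ (Coalgebra.comul (R := k) (A := H))) =
      TensorProduct.map (convIncl k H A).inv.ofConv (T.ofConv.rTensor H) ∘ₗ
        (Coalgebra.comul (R := k) (A := H)).lTensor H := by
    ext; simp
  rw [e1, e2]
  exact congrArg (· ∘ₗ (Coalgebra.comul (R := k) (A := H)).lTensor H ∘ₗ Coalgebra.comul) this

/-- A map `T'` is the composite of `T` with the adjoint coaction precisely when `convIncl` conjugates
it to `T ⊗ 1`. -/
lemma adColinear_iff (T : WithConv (H →ₗ[k] A)) (T' : WithConv (H →ₗ[k] A ⊗[k] H)) :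
    T'.ofConv = T.ofConv.rTensor H ∘ₗ adCoaction k H ↔
      (convIncl k H A).val * T' = convMap H (inclLeft k H A) T * (convIncl k H A).val := by
  have e : T'.ofConv = T.ofConv.rTensor H ∘ₗ adCoaction k H ↔
      T' = toConv (T.ofConv.rTensor H ∘ₗ adCoaction k H) :=
    ⟨fun h => ofConv_injective h, fun h => congrArg ofConv h⟩
  rw [e, rTensor_adCoaction]
  exact Units.eq_inv_mul_iff_mul_eq (convIncl k H A)

/-- For `N : P → A` and `T : H → A`, the map `p ↦ N(p₍₀₎) T(p₍₁₎)`. -/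
def coactMul (δ : P →ₐ[k] P ⊗[k] H) (N : P →ₗ[k] A) (T : WithConv (H →ₗ[k] A)) : P →ₗ[k] A :=
  LinearMap.mul' k A ∘ₗ TensorProduct.map N T.ofConv ∘ₗ δ.toLinearMap

section coactMul

variable {δ : P →ₐ[k] P ⊗[k] H}

/-- Coassociativity of `δ`, read as associativity of the right action of the convolution algebra. -/
lemma coactMul_coactMul (hδ : IsCoaction δ) (N : P →ₗ[k] A) (T U : WithConv (H →ₗ[k] A)) :
    coactMul δ (coactMul δ N T) U = coactMul δ N (T * U) := by
  have e1 : coactMul δ (coactMul δ N T) U =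
      (LinearMap.mul' k A ∘ₗ (LinearMap.mul' k A).lTensor A ∘ₗ
        TensorProduct.map N (TensorProduct.map T.ofConv U.ofConv)) ∘ₗ
      (TensorProduct.assoc k P H H).toLinearMap ∘ₗ δ.toLinearMap.rTensor H ∘ₗ δ.toLinearMap := by
    rw [← LinearMap.comp_assoc, ← LinearMap.comp_assoc, coactMul, ← LinearMap.comp_assoc]
    congr 1
    ext p h
    simp only [coactMul, TensorProduct.AlgebraTensorModule.curry_apply,
      LinearMap.restrictScalars_self, TensorProduct.curry_apply, LinearMap.comp_apply,
      TensorProduct.map_tmul, LinearMap.rTensor_tmul]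
    generalize δ.toLinearMap p = x
    induction x with
    | zero => simp
    | add x y hx hy => simp only [map_add, TensorProduct.add_tmul, hx, hy]
    | tmul q g => simp [mul_assoc]
  have e2 : (LinearMap.mul' k A ∘ₗ (LinearMap.mul' k A).lTensor A ∘ₗ
        TensorProduct.map N (TensorProduct.map T.ofConv U.ofConv)) ∘ₗ
      (Coalgebra.comul (R := k) (A := H)).lTensor P =
      LinearMap.mul' k A ∘ₗ TensorProduct.map N (T * U).ofConv := by
    ext p h
    simp [LinearMap.convMul_def]
  rw [e1, hδ.coassoc]
  exact congrArg (· ∘ₗ δ.toLinearMap) e2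

lemma coactMul_one (hδ : IsCoaction δ) (N : P →ₗ[k] A) : coactMul δ N 1 = N := by
  conv_rhs => rw [← LinearMap.comp_id N, ← hδ.counit]
  rw [coactMul, ← LinearMap.comp_assoc, ← LinearMap.comp_assoc, ← LinearMap.comp_assoc]
  congr 1
  ext p h
  simp [LinearMap.convOne_def, Algebra.algebraMap_eq_smul_one]

lemma comp_coactMul (i : A →ₐ[k] A') (N : P →ₗ[k] A) (T : WithConv (H →ₗ[k] A)) :
    i.toLinearMap ∘ₗ coactMul δ N T = coactMul δ (i.toLinearMap ∘ₗ N) (convMap H i T) := by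
  have e : i.toLinearMap ∘ₗ LinearMap.mul' k A ∘ₗ TensorProduct.map N T.ofConv =
      LinearMap.mul' k A' ∘ₗ TensorProduct.map (i.toLinearMap ∘ₗ N) (convMap H i T).ofConv := by
    ext p h
    simp
  exact congrArg (· ∘ₗ δ.toLinearMap) e

lemma coactMul_add_left (N N' : P →ₗ[k] A) (T : WithConv (H →ₗ[k] A)) :
    coactMul δ (N + N') T = coactMul δ N T + coactMul δ N' T := by
  simp [coactMul, TensorProduct.map_add_left, LinearMap.comp_add, LinearMap.add_comp]

lemma coactMul_sub_left (N N' : P →ₗ[k] A) (T : WithConv (H →ₗ[k] A)) :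
    coactMul δ (N - N') T = coactMul δ N T - coactMul δ N' T := by
  rw [eq_sub_iff_add_eq, ← coactMul_add_left, sub_add_cancel]

lemma coactMul_add_right (N : P →ₗ[k] A) (T T' : WithConv (H →ₗ[k] A)) :
    coactMul δ N (T + T') = coactMul δ N T + coactMul δ N T' := by
  simp [coactMul, TensorProduct.map_add_right, LinearMap.comp_add, LinearMap.add_comp]

lemma coactMul_sub_right (N : P →ₗ[k] A) (T T' : WithConv (H →ₗ[k] A)) :
    coactMul δ N (T - T') = coactMul δ N T - coactMul δ N T' := by
  rw [eq_sub_iff_add_eq, ← coactMul_add_right, sub_add_cancel]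

lemma rTensor_comp_coaction (N : P →ₗ[k] A) :
    N.rTensor H ∘ₗ δ.toLinearMap =
      coactMul δ ((inclLeft k H A).toLinearMap ∘ₗ N) (convIncl k H A).val := by
  rw [coactMul, ← LinearMap.comp_assoc]
  congr 1
  ext p h
  change N p ⊗ₜ[k] h = (N p ⊗ₜ[k] 1) * (1 ⊗ₜ[k] h)
  simp

lemma coactMul_apply_one (N : P →ₗ[k] A) (T : WithConv (H →ₗ[k] A)) :
    coactMul δ N T 1 = N 1 * T.ofConv 1 := by
  simp [coactMul, Algebra.TensorProduct.one_def]

end coactMul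

/-! ### The gauge group -/

section gauge

variable {δ : P →ₐ[k] P ⊗[k] H}

lemma isGauge_iff (f : (WithConv (H →ₗ[k] P))ˣ) :
    IsGauge δ f ↔ f.val.ofConv 1 = 1 ∧ (convIncl k H P).val * convMap H δ f.val =
      convMap H (inclLeft k H P) f.val * (convIncl k H P).val := by
  rw [← adColinear_iff]
  exact ⟨fun h => ⟨h.1, h.2⟩, fun h => ⟨h.1, h.2⟩⟩

lemma convMul_apply_one (T U : WithConv (H →ₗ[k] A)) :
    (T * U).ofConv 1 = T.ofConv 1 * U.ofConv 1 := by
  simp [LinearMap.convMul_def, Algebra.TensorProduct.one_def]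

lemma isGauge_one : IsGauge δ (1 : (WithConv (H →ₗ[k] P))ˣ) := by
  rw [isGauge_iff]
  exact ⟨by simp [LinearMap.convOne_def], by simp⟩

lemma IsGauge.mul {f g : (WithConv (H →ₗ[k] P))ˣ} (hf : IsGauge δ f) (hg : IsGauge δ g) :
    IsGauge δ (f * g) := by
  rw [isGauge_iff] at *
  refine ⟨by rw [Units.val_mul, convMul_apply_one, hf.1, hg.1, mul_one], ?_⟩
  rw [Units.val_mul, map_mul, map_mul, ← mul_assoc, hf.2, mul_assoc, hg.2, mul_assoc]

lemma IsGauge.inv {f : (WithConv (H →ₗ[k] P))ˣ} (hf : IsGauge δ f) : IsGauge δ f⁻¹ := by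
  rw [isGauge_iff] at *
  refine ⟨?_, ?_⟩
  · have := convMul_apply_one f.val (f⁻¹).val
    rw [hf.1, one_mul, Units.mul_inv] at this
    rw [← this]
    simp [LinearMap.convOne_def]
  · set u := (convIncl k H P).val
    -- Insert `f⁻¹ * f` between the two factors, on the `⊗ 1` side, and move `u` across by the
    -- relation for `f`.
    calc u * convMap H δ (f⁻¹).val
        = convMap H (inclLeft k H P) (f⁻¹).val * (convMap H (inclLeft k H P) f.val * u) *
            convMap H δ (f⁻¹).val := by
          rw [← mul_assoc, ← map_mul, Units.inv_mul, _root_.map_one, one_mul]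
      _ = convMap H (inclLeft k H P) (f⁻¹).val * u := by
          rw [← hf.2, mul_assoc, mul_assoc, ← map_mul, Units.mul_inv, _root_.map_one, mul_one]

variable (δ) in
/-- The group of gauge transformations. -/
def gaugeGroup : Subgroup (WithConv (H →ₗ[k] P))ˣ where
  carrier := {f | IsGauge δ f}
  one_mem' := isGauge_one
  mul_mem' := IsGauge.mul
  inv_mem' := IsGauge.inv

end gauge

/-! ### Actions and coactions in terms of convolution -/

section coact

variable {δ : P →ₐ[k] P ⊗[k] H}

lemma coactL_eq [Module P A] [IsScalarTower k P A] (i : P →ₐ[k] A)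
    (hi : ∀ (r : P) (x : A), r • x = i r * x) (T : H →ₗ[k] A) :
    coactL δ T = coactMul δ i.toLinearMap (toConv T) := by
  have e : actL k P A ∘ₗ T.lTensor P =
      LinearMap.mul' k A ∘ₗ TensorProduct.map i.toLinearMap T := by
    ext p h
    simp [actL, hi]
  exact congrArg (· ∘ₗ δ.toLinearMap) e

lemma coactL_self (T : H →ₗ[k] P) : coactL δ T = coactMul δ LinearMap.id (toConv T) :=
  coactL_eq (AlgHom.id k P) (fun _ _ => rfl) T

lemma smul_eq_inclLeft_mul (r : P) (x : P ⊗[k] A) :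
    r • x = inclLeft k A P r * x := by
  induction x with
  | zero => simp
  | add x y hx hy => simp only [smul_add, mul_add, hx, hy]
  | tmul a b => simp [TensorProduct.smul_tmul']

lemma coactL_tensor (T : H →ₗ[k] P ⊗[k] A) :
    coactL δ T = coactMul δ (inclLeft k A P).toLinearMap (toConv T) :=
  coactL_eq _ smul_eq_inclLeft_mul T

lemma comp_coactL {M M' : Type*} [AddCommGroup M] [Module k M] [Module P M]
    [IsScalarTower k P M] [AddCommGroup M'] [Module k M'] [Module P M'] [IsScalarTower k P M']
    (g : M →ₗ[P] M') (T : H →ₗ[k] M) :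
    g.restrictScalars k ∘ₗ coactL δ T = coactL δ (g.restrictScalars k ∘ₗ T) := by
  have e : g.restrictScalars k ∘ₗ actL k P M ∘ₗ T.lTensor P =
      actL k P M' ∘ₗ (g.restrictScalars k ∘ₗ T).lTensor P := by
    ext p h
    simp [actL]
  exact congrArg (· ∘ₗ δ.toLinearMap) e

/-- Colinearity means `φ(p)₍₀₎ ⊗ φ(p)₍₁₎ = φ(p₍₀₎) ⊗ p₍₁₎`, so `T` does not see `φ`. -/
lemma coactMul_comp (φ : P →ₗ[k] P) (hφ : δ.toLinearMap ∘ₗ φ = φ.rTensor H ∘ₗ δ.toLinearMap)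
    (N : P →ₗ[k] A) (T : WithConv (H →ₗ[k] A)) :
    coactMul δ N T ∘ₗ φ = coactMul δ (N ∘ₗ φ) T := by
  rw [coactMul, coactMul, LinearMap.comp_assoc, LinearMap.comp_assoc, hφ]
  have e : TensorProduct.map N T.ofConv ∘ₗ φ.rTensor H = TensorProduct.map (N ∘ₗ φ) T.ofConv := by
    ext; simp
  rw [← e, LinearMap.comp_assoc]

lemma coaction_eq_coactMul :
    δ.toLinearMap = coactMul δ (inclLeft k H P).toLinearMap (convIncl k H P).val := by
  have := rTensor_comp_coaction (δ := δ) (LinearMap.id (R := k) (M := P))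
  rwa [LinearMap.rTensor_id] at this

/-- The map `p ↦ p₍₀₎ f(p₍₁₎)` attached to a gauge transformation is colinear. -/
lemma IsGauge.colinear_coactL (hδ : IsCoaction δ) {f : (WithConv (H →ₗ[k] P))ˣ}
    (hf : IsGauge δ f) : δ.toLinearMap ∘ₗ coactL δ f.val.ofConv =
      (coactL δ f.val.ofConv).rTensor H ∘ₗ δ.toLinearMap := by
  -- Since `δ = (id ⊗ 1) * j`, the relation `(f ⊗ 1) * j = j * (δ ∘ f)` turns the right side into `δ
  -- * (δ ∘ f)`.
  rw [rTensor_comp_coaction, coactL_self, comp_coactMul, comp_coactMul, toConv_ofConv,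
    LinearMap.comp_id, LinearMap.comp_id, coactMul_coactMul hδ, ← ((isGauge_iff f).1 hf).2,
    ← coactMul_coactMul hδ, ← coaction_eq_coactMul]

/-- `F_f` is colinear, so `(id * g) ∘ F_f = F_f * g = id * (f * g)`. -/
lemma coactL_comp_coactL (hδ : IsCoaction δ) {f g : (WithConv (H →ₗ[k] P))ˣ}
    (hf : IsGauge δ f) : coactL δ g.val.ofConv ∘ₗ coactL δ f.val.ofConv =
      coactL δ (f * g).val.ofConv := by
  rw [coactL_self g.val.ofConv, coactMul_comp _ (hf.colinear_coactL hδ), LinearMap.id_comp,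
    coactL_self, coactMul_coactMul hδ, coactL_self]
  rfl

lemma coactL_one_apply (T : H →ₗ[k] P) : coactL δ T 1 = T 1 := by
  rw [coactL_self, coactMul_apply_one]
  simp

lemma coactMul_coinv_mul (N : P →ₗ[k] A) (i : coinv δ → A)
    (hN : ∀ (b : coinv δ) p, N (b * p) = i b * N p) (T : WithConv (H →ₗ[k] A)) (b : coinv δ) (p : P) :
    coactMul δ N T (b * p) = i b * coactMul δ N T p := by
  have hb : δ (b : P) = (b : P) ⊗ₜ[k] (1 : H) := b.2
  simp only [coactMul, LinearMap.comp_apply, AlgHom.toLinearMap_apply, map_mul, hb]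
  generalize δ p = x
  induction x with
  | zero => simp
  | add x y hx hy => simp only [map_add, mul_add, hx, hy]
  | tmul q g => simp [hN, mul_assoc]

lemma coactL_coinv_mul (T : H →ₗ[k] P) (b : coinv δ) (p : P) :
    coactL δ T (b * p) = b * coactL δ T p := by
  rw [coactL_self]
  exact coactMul_coinv_mul LinearMap.id (fun b => (b : P)) (fun _ _ => rfl) _ b p

/-- The inclusion `p ↦ 1 ⊗ p`. -/
abbrev inclRight (k A P : Type*) [Field k] [Ring P] [Algebra k P] [Ring A] [Algebra k A] :
    P →ₐ[k] A ⊗[k] P := Algebra.TensorProduct.includeRight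

/-- Right multiplication of the last leg by `q` is multiplication by `1 ⊗ q` in `A ⊗ P`. -/
lemma gaugeTwist_eq (f : (WithConv (H →ₗ[k] P))ˣ) (T : P →ₗ[k] A ⊗[k] P) :
    gaugeTwist δ f T =
      coactMul δ (T ∘ₗ coactL δ f.val.ofConv) (convMap H (inclRight k A P) f.inv) := by
  have e (N : P →ₗ[k] A ⊗[k] P) : actR k P A ∘ₗ TensorProduct.map N f.inv.ofConv =
      LinearMap.mul' k _ ∘ₗ TensorProduct.map N (convMap H (inclRight k A P) f.inv).ofConv := by
    ext p h
    simp only [actR, TensorProduct.AlgebraTensorModule.curry_apply,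
      LinearMap.restrictScalars_self, TensorProduct.curry_apply, LinearMap.comp_apply,
      TensorProduct.map_tmul]
    generalize N p = x
    induction x with
    | zero => simp
    | add x y hx hy => simp only [map_add, TensorProduct.add_tmul, hx, hy]
    | tmul q g => simp
  exact congrArg (· ∘ₗ δ.toLinearMap) (e (T ∘ₗ coactL δ f.val.ofConv))

lemma gaugeTwist_sub (f : (WithConv (H →ₗ[k] P))ˣ) (T T' : P →ₗ[k] A ⊗[k] P) :
    gaugeTwist δ f (T - T') = gaugeTwist δ f T - gaugeTwist δ f T' := by
  rw [gaugeTwist_eq, gaugeTwist_eq, gaugeTwist_eq, LinearMap.sub_comp, coactMul_sub_left]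

lemma gaugeTwist_one (hδ : IsCoaction δ) (T : P →ₗ[k] A ⊗[k] P) :
    gaugeTwist δ (1 : (WithConv (H →ₗ[k] P))ˣ) T = T := by
  have e : coactL δ (1 : (WithConv (H →ₗ[k] P))ˣ).val.ofConv = LinearMap.id := by
    rw [coactL_self]
    exact coactMul_one hδ _
  rw [gaugeTwist_eq, e, LinearMap.comp_id]
  change coactMul δ T (convMap H (inclRight k A P) 1) = T
  rw [map_one, coactMul_one hδ]

lemma gaugeTwist_mul (hδ : IsCoaction δ) {f g : (WithConv (H →ₗ[k] P))ˣ} (hf : IsGauge δ f)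
    (T : P →ₗ[k] A ⊗[k] P) :
    gaugeTwist δ (f * g) T = gaugeTwist δ f (gaugeTwist δ g T) := by
  rw [gaugeTwist_eq, gaugeTwist_eq, gaugeTwist_eq, coactMul_comp _ (hf.colinear_coactL hδ),
    LinearMap.comp_assoc, coactL_comp_coactL hδ hf, coactMul_coactMul hδ, ← map_mul]
  rfl

/-- Twisting `p ↦ i(p)` by right multiplication: `i(p₍₀₎ f(p₍₁₎)) i(f⁻¹(p₍₂₎)) = i(p)`. -/
lemma coactMul_gauge_inv (hδ : IsCoaction δ) (f : (WithConv (H →ₗ[k] P))ˣ) (i : P →ₐ[k] A) :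
    coactMul δ (i.toLinearMap ∘ₗ coactL δ f.val.ofConv) (convMap H i f.inv) = i.toLinearMap := by
  rw [← comp_coactMul, coactL_self, coactMul_coactMul hδ, toConv_ofConv, Units.inv_eq_val_inv,
    Units.mul_inv, coactMul_one hδ, LinearMap.comp_id]

lemma gaugeTwist_inclRight (hδ : IsCoaction δ) (f : (WithConv (H →ₗ[k] P))ˣ) :
    gaugeTwist δ f (inclRight k A P).toLinearMap = (inclRight k A P).toLinearMap := by
  rw [gaugeTwist_eq, coactMul_gauge_inv hδ]

/-- The right coaction `x ⊗ p ↦ x ⊗ p₍₀₎ ⊗ p₍₁₎` on `A ⊗ P` as an algebra homomorphism. -/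
def rightCoaction (δ : P →ₐ[k] P ⊗[k] H) (A : Type*) [Ring A] [Algebra k A] :
    A ⊗[k] P →ₐ[k] (A ⊗[k] P) ⊗[k] H :=
  (Algebra.TensorProduct.assoc k k k A P H).symm.toAlgHom.comp
    (Algebra.TensorProduct.map (AlgHom.id k A) δ)

lemma coactionB_eq : coactionB δ = (rightCoaction δ (coinv δ)).toLinearMap := by
  ext b p
  rfl

lemma rightCoaction_comp_inclRight : (rightCoaction δ A).comp (inclRight k A P) =
    (Algebra.TensorProduct.map (inclRight k A P) (AlgHom.id k H)).comp δ := by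
  ext p
  simp only [rightCoaction, AlgHom.comp_apply, Algebra.TensorProduct.includeRight_apply,
    Algebra.TensorProduct.map_tmul, map_one]
  generalize δ p = x
  induction x with
  | zero => simp
  | add x y hx hy => simp only [map_add, TensorProduct.tmul_add, hx, hy]
  | tmul q g => simp

lemma convMap_comp (i : A →ₐ[k] A') {A'' : Type*} [Ring A''] [Algebra k A''] (j : A' →ₐ[k] A'')
    (T : WithConv (H →ₗ[k] A)) : convMap H (j.comp i) T = convMap H j (convMap H i T) := rfl

lemma map_comp_inclLeft (i : A →ₐ[k] A') :
    (Algebra.TensorProduct.map i (AlgHom.id k H)).comp (inclLeft k H A) =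
      (inclLeft k H A').comp i := by
  ext a
  simp

lemma colinear_gaugeTwist (hδ : IsCoaction δ) {f : (WithConv (H →ₗ[k] P))ˣ} (hf : IsGauge δ f)
    {T : P →ₗ[k] A ⊗[k] P}
    (hT : (rightCoaction δ A).toLinearMap ∘ₗ T = T.rTensor H ∘ₗ δ.toLinearMap) :
    (rightCoaction δ A).toLinearMap ∘ₗ gaugeTwist δ f T =
      (gaugeTwist δ f T).rTensor H ∘ₗ δ.toLinearMap := by
  have hφ := hf.colinear_coactL hδ
  have hN : (rightCoaction δ A).toLinearMap ∘ₗ T ∘ₗ coactL δ f.val.ofConv =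
      (T ∘ₗ coactL δ f.val.ofConv).rTensor H ∘ₗ δ.toLinearMap := by
    rw [← LinearMap.comp_assoc, hT, LinearMap.comp_assoc, hφ, LinearMap.rTensor_comp,
      LinearMap.comp_assoc]
  -- The intertwining relation for the gauge transformation `f⁻¹`, pushed forward along `p ↦ 1 ⊗ p`.
  have hinv := congrArg (convMap H (Algebra.TensorProduct.map (inclRight k A P) (AlgHom.id k H)))
    ((isGauge_iff _).1 hf.inv).2
  rw [map_mul, map_mul, convMap_convIncl, ← convMap_comp, ← convMap_comp, map_comp_inclLeft,
    ← rightCoaction_comp_inclRight, convMap_comp, convMap_comp] at hinv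
  rw [rTensor_comp_coaction] at hN ⊢
  rw [gaugeTwist_eq, comp_coactMul, comp_coactMul, hN, coactMul_coactMul hδ, coactMul_coactMul hδ]
  exact congrArg _ hinv

end coact

/-! ### The diagonal coaction -/

section diag

variable {δ : P →ₐ[k] P ⊗[k] H}

/-- For noncommutative `H` the diagonal coaction need not be multiplicative. It does respect left
multiplication by `r`, because the `H`-leg of `r` stands first in the product. -/
lemma diagCoaction_smul (r : P) (x : P ⊗[k] P) :
    diagCoaction δ (r • x) =
      Algebra.TensorProduct.map (inclLeft k P P) (AlgHom.id k H) (δ r) * diagCoaction δ x := by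
  have key : ∀ s s' t : P ⊗[k] H,
      (LinearMap.mul' k H).lTensor (P ⊗[k] P)
        (TensorProduct.tensorTensorTensorComm k P H P H ((s * s') ⊗ₜ t)) =
      Algebra.TensorProduct.map (inclLeft k P P) (AlgHom.id k H) s *
      (LinearMap.mul' k H).lTensor (P ⊗[k] P)
        (TensorProduct.tensorTensorTensorComm k P H P H (s' ⊗ₜ t)) := by
    intro s s' t
    induction s with
    | zero => simp
    | add a b ha hb => simp only [add_mul, TensorProduct.add_tmul, map_add, ha, hb]
    | tmul a b =>
    induction s' with
    | zero => simp
    | add a b ha hb => simp only [mul_add, TensorProduct.add_tmul, map_add, ha, hb]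
    | tmul a' b' =>
    induction t with
    | zero => simp
    | add a b ha hb => simp only [mul_add, TensorProduct.tmul_add, map_add, ha, hb]
    | tmul c e => simp [mul_assoc]
  induction x with
  | zero => simp
  | add a b ha hb => simp only [smul_add, map_add, mul_add, ha, hb]
  | tmul p q => simp [diagCoaction, key, TensorProduct.smul_tmul']

lemma diagCoaction_coactL (w : H →ₗ[k] P ⊗[k] P) :
    diagCoaction δ ∘ₗ coactL δ w =
      coactMul δ ((Algebra.TensorProduct.map (inclLeft k P P) (AlgHom.id k H)).comp δ).toLinearMap
        (toConv (diagCoaction δ ∘ₗ w)) := by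
  have e : diagCoaction δ ∘ₗ actL k P (P ⊗[k] P) ∘ₗ w.lTensor P =
      LinearMap.mul' k _ ∘ₗ TensorProduct.map
        ((Algebra.TensorProduct.map (inclLeft k P P) (AlgHom.id k H)).comp δ).toLinearMap
        (diagCoaction δ ∘ₗ w) := by
    ext p h
    simp [actL, diagCoaction_smul]
    rfl
  exact congrArg (· ∘ₗ δ.toLinearMap) e

/-- With `rTensor_coactL_eq`, this writes both sides of colinearity as `(p ⊗ 1) ⊗ 1` times a map on
`H`. The two maps on `H` are the sides of `adColinear_iff`. -/
lemma diagCoaction_coactL_eq (hδ : IsCoaction δ) (w : H →ₗ[k] P ⊗[k] P) :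
    diagCoaction δ ∘ₗ coactL δ w =
      coactMul δ ((inclLeft k H (P ⊗[k] P)).comp (inclLeft k P P)).toLinearMap
        ((convIncl k H (P ⊗[k] P)).val * toConv (diagCoaction δ ∘ₗ w)) := by
  rw [diagCoaction_coactL, ← coactMul_coactMul hδ]
  congr 1
  rw [← map_comp_inclLeft, ← convMap_convIncl (inclLeft k P P), AlgHom.comp_toLinearMap,
    AlgHom.comp_toLinearMap, ← comp_coactMul, ← coaction_eq_coactMul]

lemma rTensor_coactL_eq (hδ : IsCoaction δ) (w : H →ₗ[k] P ⊗[k] P) :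
    (coactL δ w).rTensor H ∘ₗ δ.toLinearMap =
      coactMul δ ((inclLeft k H (P ⊗[k] P)).comp (inclLeft k P P)).toLinearMap
        (convMap H (inclLeft k H (P ⊗[k] P)) (toConv w) * (convIncl k H (P ⊗[k] P)).val) := by
  rw [rTensor_comp_coaction, coactL_tensor, comp_coactMul, coactMul_coactMul hδ]
  rfl

-- Coinvariants contribute `1` to the `H`-leg. Colinearity of maps into `B ⊗ P` can therefore be
-- tested in `P ⊗ P`.
set_option synthInstance.maxHeartbeats 100000 in
lemma diagCoaction_inclB (x : coinv δ ⊗[k] P) :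
    diagCoaction δ (inclB δ x) = (inclB δ).rTensor H (coactionB δ x) := by
  induction x with
  | zero => simp
  | add x y hx hy => simp only [map_add, hx, hy]
  | tmul b p =>
    have hb : δ (b : P) = (b : P) ⊗ₜ[k] (1 : H) := b.2
    simp only [diagCoaction, inclB, coactionB, LinearMap.comp_apply, LinearMap.rTensor_tmul,
      TensorProduct.map_tmul, AlgHom.toLinearMap_apply, Subalgebra.coe_val, hb,
      LinearMap.lTensor_tmul, LinearEquiv.coe_coe]
    generalize δ p = y
    induction y with
    | zero => simp only [map_zero, TensorProduct.tmul_zero]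
    | add x y hx hy => simp only [map_add, TensorProduct.tmul_add, hx, hy]
    | tmul q g => simp

lemma diagCoaction_comp_inclLeft : diagCoaction δ ∘ₗ (inclLeft k P P).toLinearMap =
    (inclLeft k P P).toLinearMap.rTensor H ∘ₗ δ.toLinearMap := by
  ext p
  simp only [diagCoaction, LinearMap.comp_apply, AlgHom.toLinearMap_apply,
    Algebra.TensorProduct.includeLeft_apply, TensorProduct.map_tmul, map_one,
    Algebra.TensorProduct.one_def]
  generalize δ p = y
  induction y with
  | zero => simp
  | add x y hx hy => simp only [map_add, TensorProduct.add_tmul, hx, hy]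
  | tmul q g => simp

lemma diagCoaction_comp_inclRight : diagCoaction δ ∘ₗ (inclRight k P P).toLinearMap =
    (inclRight k P P).toLinearMap.rTensor H ∘ₗ δ.toLinearMap := by
  ext p
  simp only [diagCoaction, LinearMap.comp_apply, AlgHom.toLinearMap_apply,
    Algebra.TensorProduct.includeRight_apply, TensorProduct.map_tmul, map_one,
    Algebra.TensorProduct.one_def]
  generalize δ p = y
  induction y with
  | zero => simp
  | add x y hx hy => simp only [map_add, TensorProduct.tmul_add, hx, hy]
  | tmul q g => simp

end diag

/-! ### Maps out of the universal calculus -/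

section Omega

variable {M : Type*} [AddCommGroup M] [Module k M] [Module P M] [IsScalarTower k P M]

/-- The left `P`-linear extension `r ⊗ p ↦ r E(p)` of a linear map `E : P → M`. -/
def extendLeft (E : P →ₗ[k] M) : P ⊗[k] P →ₗ[P] M where
  toFun x := actL k P M (E.lTensor P x)
  map_add' x y := by simp
  map_smul' r x := by
    induction x with
    | zero => simp
    | add x y hx hy => simp only [smul_add, map_add, hx, hy]
    | tmul a b => simp [TensorProduct.smul_tmul', actL]

lemma extendLeft_apply (E : P →ₗ[k] M) (x : P ⊗[k] P) :
    extendLeft E x = actL k P M (E.lTensor P x) := rfl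

@[simp] lemma extendLeft_tmul (E : P →ₗ[k] M) (r p : P) :
    extendLeft E (r ⊗ₜ[k] p) = r • E p := by
  simp [extendLeft_apply, actL]

lemma Omega.proj_coe (x : Omega k P) : Omega.proj k P (x : P ⊗[k] P) = x := by
  have hx : LinearMap.mul' k P (x : P ⊗[k] P) = 0 := x.2
  ext
  simp [Omega.proj, hx]

lemma Omega.coe_proj {x : P ⊗[k] P} (hx : LinearMap.mul' k P x = 0) :
    (Omega.proj k P x : P ⊗[k] P) = x := by
  simp [Omega.proj, hx]

lemma Omega.proj_tmul (r p : P) : Omega.proj k P (r ⊗ₜ[k] p) = r • d k p := by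
  ext
  rw [Submodule.coe_smul, coe_d]
  simp [Omega.proj, smul_sub, TensorProduct.smul_tmul']

lemma extendLeft_comp_d (Q : Omega k P →ₗ[P] M) (x : P ⊗[k] P) :
    extendLeft (Q.restrictScalars k ∘ₗ d k) x = Q (Omega.proj k P x) := by
  induction x with
  | zero => simp
  | add x y hx hy => simp only [map_add, hx, hy]
  | tmul a b => simp [Omega.proj_tmul]

lemma Omega.hom_ext {Q Q' : Omega k P →ₗ[P] M} (h : ∀ p, Q (d k p) = Q' (d k p)) : Q = Q' := by
  have e : Q.restrictScalars k ∘ₗ d k = Q'.restrictScalars k ∘ₗ d k := LinearMap.ext h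
  ext x
  rw [← Omega.proj_coe x, ← extendLeft_comp_d, e, extendLeft_comp_d]

lemma d_one : d k (1 : P) = 0 := by
  ext
  simp [coe_d]

lemma extendLeft_d (E : P →ₗ[k] M) (hE : E 1 = 0) (p : P) :
    extendLeft E (d k p : P ⊗[k] P) = E p := by
  simp [coe_d, hE]

lemma incl_comp_d : Omega.incl k P ∘ₗ d k =
    (inclRight k P P).toLinearMap - (inclLeft k P P).toLinearMap := by
  ext p
  simp [Omega.incl, coe_d]

end Omega

/-! ### Colinear maps -/

lemma rTensor_injective {V W : Type*} [AddCommGroup V] [Module k V] [AddCommGroup W] [Module k W]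
    (H : Type*) [AddCommGroup H] [Module k H]
    {g : V →ₗ[k] W} (hg : Function.Injective g) : Function.Injective (g.rTensor H) :=
  Module.Flat.rTensor_preserves_injective_linearMap g hg

section Intertwines

variable {U V W : Type*} [AddCommGroup U] [Module k U] [AddCommGroup V] [Module k V]
  [AddCommGroup W] [Module k W]

/-- `N` intertwines the coactions `ρ` and `σ`. -/
def Intertwines (ρ : U →ₗ[k] U ⊗[k] H) (σ : V →ₗ[k] V ⊗[k] H) (N : U →ₗ[k] V) : Prop :=
  σ ∘ₗ N = N.rTensor H ∘ₗ ρ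

variable {ρ : U →ₗ[k] U ⊗[k] H} {σ : V →ₗ[k] V ⊗[k] H} {τ : W →ₗ[k] W ⊗[k] H}

lemma Intertwines.comp {N : U →ₗ[k] V} {L : V →ₗ[k] W} (hL : Intertwines σ τ L)
    (hN : Intertwines ρ σ N) : Intertwines ρ τ (L ∘ₗ N) := by
  unfold Intertwines at *
  rw [← LinearMap.comp_assoc, hL, LinearMap.comp_assoc, hN, LinearMap.rTensor_comp,
    LinearMap.comp_assoc]

lemma Intertwines.sub {N N' : U →ₗ[k] V} (hN : Intertwines ρ σ N) (hN' : Intertwines ρ σ N') :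
    Intertwines ρ σ (N - N') := by
  unfold Intertwines at *
  rw [LinearMap.comp_sub, hN, hN', LinearMap.rTensor_sub, LinearMap.sub_comp]

lemma Intertwines.add {N N' : U →ₗ[k] V} (hN : Intertwines ρ σ N) (hN' : Intertwines ρ σ N') :
    Intertwines ρ σ (N + N') := by
  unfold Intertwines at *
  rw [LinearMap.comp_add, hN, hN', LinearMap.rTensor_add, LinearMap.add_comp]

/-- Colinearity can be checked after composition with an injective colinear map. -/
lemma Intertwines.of_comp {N : U →ₗ[k] V} {L : V →ₗ[k] W} (hL : Intertwines σ τ L)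
    (inj : Function.Injective L) (h : Intertwines ρ τ (L ∘ₗ N)) : Intertwines ρ σ N := by
  unfold Intertwines at *
  rw [← LinearMap.comp_assoc, hL, LinearMap.rTensor_comp, LinearMap.comp_assoc,
    LinearMap.comp_assoc] at h
  exact LinearMap.ext fun x => rTensor_injective H inj (LinearMap.congr_fun h x)

end Intertwines

lemma incl_injective : Function.Injective (Omega.incl k P) := Subtype.val_injective

section descr

variable {δ : P →ₐ[k] P ⊗[k] H}

lemma intertwines_incl : Intertwines (omegaCoaction δ) (diagCoaction δ) (Omega.incl k P) :=
  LinearMap.ext fun x => (incl_omegaCoaction δ x).symm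

/-- Both sides send `r ⊗ p` to `r₍₀₎ N(p₍₀₎) ⊗ r₍₁₎ p₍₁₎`. -/
lemma Intertwines.extendLeft {N : P →ₗ[k] P ⊗[k] P}
    (hN : Intertwines δ.toLinearMap (diagCoaction δ) N) :
    Intertwines (diagCoaction δ) (diagCoaction δ) ((HopfGalois.extendLeft N).restrictScalars k) := by
  unfold Intertwines at *
  ext r p
  have hp : diagCoaction δ (N p) = N.rTensor H (δ p) := LinearMap.congr_fun hN p
  simp only [TensorProduct.AlgebraTensorModule.curry_apply, LinearMap.restrictScalars_self,
    TensorProduct.curry_apply, LinearMap.comp_apply, LinearMap.restrictScalars_apply,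
    extendLeft_tmul, diagCoaction_smul, hp]
  simp only [diagCoaction, LinearMap.comp_apply, TensorProduct.map_tmul,
    AlgHom.toLinearMap_apply]
  generalize δ p = y
  generalize δ r = x
  induction x with
  | zero => simp
  | add x y hx hy => simp only [map_add, TensorProduct.add_tmul, add_mul, hx, hy]
  | tmul a b =>
  induction y with
  | zero => simp
  | add x y hx hy => simp only [map_add, TensorProduct.tmul_add, mul_add, hx, hy]
  | tmul c e => simp [smul_eq_inclLeft_mul]

/-! ### The inclusion of `B ⊗ P` -/

lemma inclB_injective : Function.Injective (inclB δ) :=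
  rTensor_injective P (Subtype.val_injective : Function.Injective (coinv δ).val.toLinearMap)

@[simp] lemma inclB_tmul (b : coinv δ) (p : P) : inclB δ (b ⊗ₜ[k] p) = (b : P) ⊗ₜ[k] p := by
  simp [inclB]

@[simp] lemma mulB_tmul (b : coinv δ) (p : P) : mulB δ (b ⊗ₜ[k] p) = (b : P) * p := by
  simp [mulB, actL, Subalgebra.smul_def]

lemma inclB_smul (b : coinv δ) (x : coinv δ ⊗[k] P) : inclB δ (b • x) = (b : P) • inclB δ x := by
  induction x with
  | zero => simp
  | add x y hx hy => simp only [map_add, smul_add, hx, hy]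
  | tmul c p => simp [TensorProduct.smul_tmul']

lemma mulB_smul (b : coinv δ) (x : coinv δ ⊗[k] P) : mulB δ (b • x) = (b : P) * mulB δ x := by
  induction x with
  | zero => simp
  | add x y hx hy => simp only [map_add, smul_add, mul_add, hx, hy]
  | tmul c p => simp [TensorProduct.smul_tmul', mul_assoc]

lemma mul_inclB (x : coinv δ ⊗[k] P) : LinearMap.mul' k P (inclB δ x) = mulB δ x := by
  induction x with
  | zero => simp
  | add x y hx hy => simp only [map_add, hx, hy]
  | tmul c p => simp

lemma inclB_comp_inclRight : inclB δ ∘ₗ (inclRight k (coinv δ) P).toLinearMap =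
    (inclRight k P P).toLinearMap := by
  ext p
  simp

lemma proj_inclB_mem (x : coinv δ ⊗[k] P) : Omega.proj k P (inclB δ x) ∈ BdP δ := by
  induction x with
  | zero => simp
  | add x y hx hy => simpa only [map_add] using add_mem hx hy
  | tmul c p =>
    rw [inclB_tmul, Omega.proj_tmul]
    exact Submodule.subset_span ⟨c, p, rfl⟩

variable (δ) in
/-- A linear retraction of the inclusion `B ⊗ P → P ⊗ P`. -/
def retractB : P ⊗[k] P →ₗ[k] coinv δ ⊗[k] P :=
  (LinearMap.exists_leftInverse_of_injective (inclB δ)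
    (LinearMap.ker_eq_bot.2 inclB_injective)).choose

lemma retractB_inclB (x : coinv δ ⊗[k] P) : retractB δ (inclB δ x) = x :=
  LinearMap.congr_fun (LinearMap.exists_leftInverse_of_injective (inclB δ)
    (LinearMap.ker_eq_bot.2 inclB_injective)).choose_spec x

lemma inclB_retractB {x : P ⊗[k] P} (hx : x ∈ LinearMap.range (inclB δ)) :
    inclB δ (retractB δ x) = x := by
  obtain ⟨y, rfl⟩ := hx
  rw [retractB_inclB]

lemma intertwines_inclB : Intertwines (coactionB δ) (diagCoaction δ) (inclB δ) :=
  LinearMap.ext diagCoaction_inclB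

lemma intertwines_inclRight :
    Intertwines δ.toLinearMap (coactionB δ) (inclRight k (coinv δ) P).toLinearMap := by
  apply intertwines_inclB.of_comp inclB_injective
  rw [inclB_comp_inclRight]
  exact diagCoaction_comp_inclRight

/-! ### Splittings and covariant differentials -/

/-- The splitting `p ↦ 1 ⊗ p - D p`. -/
def CovariantDifferential.splittingMap (D : CovariantDifferential δ) :
    P →ₗ[coinv δ] coinv δ ⊗[k] P where
  toFun p := 1 ⊗ₜ[k] p - D.toMap p
  map_add' p q := by
    rw [TensorProduct.tmul_add, map_add, add_sub_add_comm]
  map_smul' b p := by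
    rw [Subalgebra.smul_def, smul_eq_mul, D.leibniz]
    simp only [smul_sub, TensorProduct.smul_tmul', smul_eq_mul, mul_one, RingHom.id_apply]
    abel

lemma CovariantDifferential.restrictScalars_splittingMap (D : CovariantDifferential δ) :
    D.splittingMap.restrictScalars k = (inclRight k (coinv δ) P).toLinearMap - D.toMap := by
  ext p
  rfl

lemma CovariantDifferential.intertwines (D : CovariantDifferential δ) :
    Intertwines δ.toLinearMap (coactionB δ) D.toMap := D.colinear

lemma StrongSplitting.intertwines (s : StrongSplitting δ) :
    Intertwines δ.toLinearMap (coactionB δ) (s.toMap.restrictScalars k) := s.colinear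

/-- The splitting `p ↦ 1 ⊗ p - D p` of a covariant differential. -/
def CovariantDifferential.toSplitting (D : CovariantDifferential δ) : StrongSplitting δ where
  toMap := D.splittingMap
  map_one := by simp [CovariantDifferential.splittingMap, D.map_one]
  splits p := by
    have : mulB δ (D.toMap p) = 0 := D.mem p
    simp [CovariantDifferential.splittingMap, this]
  colinear := by
    have := intertwines_inclRight.sub D.intertwines
    rw [← D.restrictScalars_splittingMap] at this
    exact this

/-- The covariant differential `p ↦ 1 ⊗ p - s p` of a splitting. -/
def StrongSplitting.toDifferential (s : StrongSplitting δ) : CovariantDifferential δ where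
  toMap := (inclRight k (coinv δ) P).toLinearMap - s.toMap.restrictScalars k
  mem p := by
    change mulB δ _ = 0
    simp [s.splits]
  map_one := by simp [s.map_one]
  leibniz b p := by
    have := s.toMap.map_smul b p
    rw [Subalgebra.smul_def, smul_eq_mul] at this
    simp [this, smul_sub, TensorProduct.smul_tmul']
  colinear := intertwines_inclRight.sub s.intertwines

variable (δ) in
/-- Splittings and covariant differentials correspond by `D p = 1 ⊗ p - s p`. -/
def splittingEquivDifferential : StrongSplitting δ ≃ CovariantDifferential δ where
  toFun := StrongSplitting.toDifferential
  invFun := CovariantDifferential.toSplitting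
  left_inv s := by
    apply StrongSplitting.ext
    ext p
    exact sub_sub_cancel (1 ⊗ₜ[k] p) (s.toMap p)
  right_inv D := by
    apply CovariantDifferential.ext
    ext p
    exact sub_sub_cancel (1 ⊗ₜ[k] p) (D.toMap p)

lemma splittingEquivDifferential_apply (s : StrongSplitting δ) (p : P) :
    (splittingEquivDifferential δ s).toMap p = 1 ⊗ₜ[k] p - s.toMap p := rfl

/-! ### Covariant differentials and connections -/

/-- The vertical part `p ↦ dp - Dp` of the universal differential. -/
def CovariantDifferential.vert (D : CovariantDifferential δ) : P →ₗ[k] Omega k P :=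
  d k - Omega.proj k P ∘ₗ inclB δ ∘ₗ D.toMap



lemma CovariantDifferential.mul_inclB (D : CovariantDifferential δ) (p : P) :
    LinearMap.mul' k P (inclB δ (D.toMap p)) = 0 := by
  rw [HopfGalois.mul_inclB]
  exact D.mem p

lemma CovariantDifferential.coe_vert (D : CovariantDifferential δ) (p : P) :
    (D.vert p : P ⊗[k] P) = d k p - inclB δ (D.toMap p) := by
  simp [vert, Omega.coe_proj (D.mul_inclB p)]

lemma CovariantDifferential.incl_comp_vert (D : CovariantDifferential δ) :
    Omega.incl k P ∘ₗ D.vert = Omega.incl k P ∘ₗ d k - inclB δ ∘ₗ D.toMap :=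
  LinearMap.ext D.coe_vert

lemma CovariantDifferential.vert_one (D : CovariantDifferential δ) : D.vert 1 = 0 := by
  simp [vert, d_one, D.map_one]

/-- The term `db.p` occurs in both `d(bp)` and `D(bp)` and cancels. -/
lemma CovariantDifferential.vert_mul (D : CovariantDifferential δ) (b : coinv δ) (p : P) :
    D.vert (b * p) = (b : P) • D.vert p := by
  ext
  rw [Submodule.coe_smul, coe_vert, coe_vert, D.leibniz, coe_d, coe_d]
  simp only [map_add, map_sub, inclB_tmul, inclB_smul, smul_sub, TensorProduct.smul_tmul',
    smul_eq_mul, mul_one, OneMemClass.coe_one]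
  abel

/-- On `B ⊗ P` the extension factors through multiplication, so it annihilates `(Ω¹B)P`. Idempotency
and strongness both rest on this. -/
lemma CovariantDifferential.extendLeft_vert_inclB (D : CovariantDifferential δ) (x : coinv δ ⊗[k] P) :
    extendLeft D.vert (inclB δ x) = D.vert (mulB δ x) := by
  induction x with
  | zero => simp
  | add x y hx hy => simp only [map_add, hx, hy]
  | tmul b p => simp [D.vert_mul]

lemma intertwines_d : Intertwines δ.toLinearMap (omegaCoaction δ) (d k) := by
  apply intertwines_incl.of_comp incl_injective
  rw [incl_comp_d]
  exact Intertwines.sub diagCoaction_comp_inclRight diagCoaction_comp_inclLeft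

lemma CovariantDifferential.intertwines_vert (D : CovariantDifferential δ) :
    Intertwines δ.toLinearMap (omegaCoaction δ) D.vert := by
  apply intertwines_incl.of_comp incl_injective
  rw [D.incl_comp_vert]
  exact (intertwines_incl.comp intertwines_d).sub (intertwines_inclB.comp D.colinear)

/-- The connection `r dp ↦ r (dp - Dp)` of a covariant differential. -/
def CovariantDifferential.toConnection (D : CovariantDifferential δ) : StrongConnection δ where
  toMap := extendLeft D.vert ∘ₗ (Omega k P).subtype
  idem := by
    have hd (p : P) : (extendLeft D.vert ∘ₗ (Omega k P).subtype) (d k p) = D.vert p :=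
      extendLeft_d D.vert D.vert_one p
    have hz (p : P) : extendLeft D.vert (inclB δ (D.toMap p)) = 0 := by
      have : mulB δ (D.toMap p) = 0 := D.mem p
      rw [D.extendLeft_vert_inclB, this, map_zero]
    have : (extendLeft D.vert ∘ₗ (Omega k P).subtype) ∘ₗ
        (extendLeft D.vert ∘ₗ (Omega k P).subtype) = extendLeft D.vert ∘ₗ (Omega k P).subtype := by
      apply Omega.hom_ext
      intro p
      rw [LinearMap.comp_apply, hd]
      change extendLeft D.vert (D.vert p : P ⊗[k] P) = _
      rw [D.coe_vert, map_sub, hz, sub_zero, extendLeft_d D.vert D.vert_one]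
    exact fun x => LinearMap.congr_fun this x
  colinear := by
    refine intertwines_incl.of_comp incl_injective ?_
    have e : Omega.incl k P ∘ₗ (extendLeft D.vert ∘ₗ (Omega k P).subtype).restrictScalars k =
        (extendLeft (Omega.incl k P ∘ₗ D.vert)).restrictScalars k ∘ₗ Omega.incl k P := by
      have : (Omega k P).subtype ∘ₗ extendLeft D.vert = extendLeft (Omega.incl k P ∘ₗ D.vert) := by
        ext r
        simp [Omega.incl]
      exact congrArg (LinearMap.restrictScalars k · ∘ₗ Omega.incl k P) this
    rw [e]
    exact (intertwines_incl.comp D.intertwines_vert).extendLeft.comp intertwines_incl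
  strong := by
    apply le_antisymm
    · rw [BdP, Submodule.map_span, Submodule.span_le]
      rintro _ ⟨_, ⟨b, p, rfl⟩, rfl⟩
      -- `(id - Π)(b dp) = b Dp`.
      refine ⟨b • D.toMap p, ?_, ?_⟩
      · have : mulB δ (D.toMap p) = 0 := D.mem p
        change mulB δ _ = 0
        rw [mulB_smul, this, mul_zero]
      · have : (extendLeft D.vert ∘ₗ (Omega k P).subtype) (d k p) = D.vert p :=
          extendLeft_d D.vert D.vert_one p
        rw [inclB_smul, LinearMap.comp_apply, LinearMap.sub_apply, LinearMap.id_apply,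
          LinearMap.restrictScalars_apply, map_smul, this]
        change _ = (b : P) • (d k p : P ⊗[k] P) - (b : P) • (D.vert p : P ⊗[k] P)
        rw [← smul_sub, D.coe_vert, sub_sub_cancel]
    · rintro _ ⟨x, hx, rfl⟩
      have hx0 : mulB δ x = 0 := hx
      have hm : LinearMap.mul' k P (inclB δ x) = 0 := by rw [HopfGalois.mul_inclB, hx0]
      -- An element of `(Ω¹B)P` lies in `B dP` and is killed by `Π`, so it is its own preimage under
      -- `id - Π`.
      refine ⟨_, proj_inclB_mem x, ?_⟩
      have : (extendLeft D.vert ∘ₗ (Omega k P).subtype) (Omega.proj k P (inclB δ x)) = 0 := by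
        change extendLeft D.vert (Omega.proj k P (inclB δ x) : P ⊗[k] P) = 0
        rw [Omega.coe_proj hm, D.extendLeft_vert_inclB, hx0, map_zero]
      rw [LinearMap.comp_apply, LinearMap.sub_apply, LinearMap.id_apply,
          LinearMap.restrictScalars_apply, this, sub_zero]
      exact Omega.coe_proj hm

lemma CovariantDifferential.toConnection_d (D : CovariantDifferential δ) (p : P) : D.toConnection.toMap (d k p) = D.vert p :=
  extendLeft_d D.vert D.vert_one p

lemma StrongConnection.sub_mem (Q : StrongConnection δ) (p : P) :
    ((d k p - Q.toMap (d k p) : Omega k P) : P ⊗[k] P) ∈ OmegaBP δ := by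
  rw [← Q.strong]
  exact ⟨d k p, Submodule.subset_span ⟨1, p, by simp⟩, rfl⟩

/-- The covariant differential `p ↦ dp - Π(dp)` of a connection, with values in `B ⊗ P`. -/
def StrongConnection.hor (Q : StrongConnection δ) : P →ₗ[k] coinv δ ⊗[k] P :=
  retractB δ ∘ₗ Omega.incl k P ∘ₗ (d k - Q.toMap.restrictScalars k ∘ₗ d k)

lemma OmegaBP_le_range : OmegaBP δ ≤ LinearMap.range (inclB δ) := by
  rintro _ ⟨x, -, rfl⟩
  exact ⟨x, rfl⟩

lemma StrongConnection.inclB_hor (Q : StrongConnection δ) (p : P) :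
    inclB δ (Q.hor p) = ((d k p - Q.toMap (d k p) : Omega k P) : P ⊗[k] P) :=
  inclB_retractB (OmegaBP_le_range (Q.sub_mem p))

/-- By strongness such an `x` is a value of `id - Π`, and `Π (id - Π) = 0`. -/
lemma StrongConnection.map_eq_zero (Q : StrongConnection δ) {x : Omega k P}
    (hx : (x : P ⊗[k] P) ∈ OmegaBP δ) : Q.toMap x = 0 := by
  rw [← Q.strong] at hx
  obtain ⟨y, -, hy⟩ := hx
  have : x = y - Q.toMap y := Subtype.ext hy.symm
  rw [this, map_sub, Q.idem, sub_self]

/-- The covariant differential of a connection. -/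
def StrongConnection.toDifferential (Q : StrongConnection δ) : CovariantDifferential δ where
  toMap := Q.hor
  mem p := by
    obtain ⟨x, hx, e⟩ := Q.sub_mem p
    rw [← Q.inclB_hor] at e
    rwa [← inclB_injective e]
  map_one := by
    apply inclB_injective
    rw [Q.inclB_hor, d_one]
    simp
  leibniz b p := by
    -- The Leibniz rule is `d(bp) = b dp + db.p` with `id - Π` applied: `db.p` lies in `(Ω¹B)P`,
    -- where `Π` vanishes.
    have e : (Omega.proj k P (inclB δ (1 ⊗ₜ[k] ((b : P) * p) - b ⊗ₜ[k] p)) : P ⊗[k] P) =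
        inclB δ (1 ⊗ₜ[k] ((b : P) * p) - b ⊗ₜ[k] p) :=
      Omega.coe_proj (by simp)
    have hQ : Q.toMap (Omega.proj k P (inclB δ (1 ⊗ₜ[k] ((b : P) * p) - b ⊗ₜ[k] p))) = 0 := by
      apply Q.map_eq_zero
      rw [e]
      refine ⟨_, ?_, rfl⟩
      change mulB δ _ = 0
      simp
    have hd : d k ((b : P) * p) = (b : P) • d k p +
        Omega.proj k P (inclB δ (1 ⊗ₜ[k] ((b : P) * p) - b ⊗ₜ[k] p)) := by
      ext
      rw [Submodule.coe_add, e, Submodule.coe_smul, coe_d, coe_d]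
      simp [smul_sub, TensorProduct.smul_tmul']
    apply inclB_injective
    rw [map_add, inclB_smul, Q.inclB_hor, Q.inclB_hor, hd, map_add, hQ, map_smul, add_zero,
      add_sub_right_comm, Submodule.coe_add, e, Submodule.coe_sub, Submodule.coe_sub,
      Submodule.coe_smul, Submodule.coe_smul, smul_sub]
  colinear := by
    refine intertwines_inclB.of_comp inclB_injective ?_
    have e : inclB δ ∘ₗ Q.hor = Omega.incl k P ∘ₗ (d k - Q.toMap.restrictScalars k ∘ₗ d k) :=
      LinearMap.ext Q.inclB_hor
    rw [e]
    exact intertwines_incl.comp (intertwines_d.sub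
      (Intertwines.comp (σ := omegaCoaction δ) Q.colinear intertwines_d))

variable (δ) in
/-- Covariant differentials and connections correspond by `Π(r dp) = r (dp - Dp)`. -/
def differentialEquivConnection : CovariantDifferential δ ≃ StrongConnection δ where
  toFun D := D.toConnection
  invFun Q := Q.toDifferential
  left_inv D := by
    ext p
    apply inclB_injective
    change inclB δ (D.toConnection.hor p) = _
    rw [StrongConnection.inclB_hor, D.toConnection_d, Submodule.coe_sub, D.coe_vert,
      sub_sub_cancel]
  right_inv Q := by
    apply StrongConnection.ext
    apply Omega.hom_ext
    intro p
    rw [CovariantDifferential.toConnection_d]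
    ext
    rw [CovariantDifferential.coe_vert]
    change _ - inclB δ (Q.hor p) = _
    rw [Q.inclB_hor, Submodule.coe_sub, sub_sub_cancel]

end descr

variable {δ : P →ₐ[k] P ⊗[k] H}

/-! ### The canonical map -/

lemma preCan_tmul (r p : P) : preCan δ (r ⊗ₜ[k] p) = r • δ p := by
  simp only [preCan, LinearMap.comp_apply, LinearMap.lTensor_tmul, AlgHom.toLinearMap_apply]
  generalize δ p = y
  induction y with
  | zero => simp
  | add x y hx hy => simp only [map_add, TensorProduct.tmul_add, smul_add, hx, hy]
  | tmul q g => simp [TensorProduct.smul_tmul']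

lemma preCan_smul (r : P) (x : P ⊗[k] P) : preCan δ (r • x) = r • preCan δ x := by
  induction x with
  | zero => simp
  | add x y hx hy => simp only [map_add, smul_add, hx, hy]
  | tmul a b => simp [TensorProduct.smul_tmul', preCan_tmul, mul_smul]

lemma preCan_inclB (x : coinv δ ⊗[k] P) : preCan δ (inclB δ x) = δ (mulB δ x) := by
  induction x with
  | zero => simp
  | add x y hx hy => simp only [map_add, hx, hy]
  | tmul b p =>
    have hb : δ (b : P) = (b : P) ⊗ₜ[k] (1 : H) := b.2
    rw [inclB_tmul, mulB_tmul, preCan_tmul, map_mul, hb, smul_eq_inclLeft_mul]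
    rfl

lemma IsHopfGalois.surjective_preCan (hδ : IsHopfGalois δ) : Function.Surjective (preCan δ) := by
  intro x
  obtain ⟨y, rfl⟩ := hδ.bijective_can.2 x
  obtain ⟨t, rfl⟩ := (balancing δ).mkQ_surjective y
  exact ⟨t, rfl⟩

lemma IsHopfGalois.sub_mem_balancing (hδ : IsHopfGalois δ) {t t' : P ⊗[k] P}
    (h : preCan δ t = preCan δ t') : t - t' ∈ balancing δ := by
  rw [← Submodule.Quotient.eq]
  exact hδ.bijective_can.1 h

lemma preCan_eq_of_mkQ_eq (hδ : IsHopfGalois δ) {h : H} {t : P ⊗[k] P}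
    (ht : (balancing δ).mkQ t = translation hδ h) : preCan δ t = 1 ⊗ₜ[k] h := by
  have : can δ ((balancing δ).mkQ t) = can δ (translation hδ h) := congrArg _ ht
  exact this.trans ((LinearEquiv.ofBijective (can δ) hδ.bijective_can).apply_symm_apply _)

section coactL

variable {M : Type*} [AddCommGroup M] [Module k M] [Module P M] [IsScalarTower k P M]

/-- The map `r ⊗ p ↦ r p₍₀₎ T(p₍₁₎)` sees only the image under the canonical map. Evaluated on a
lift of `1 ⊗ h`, it recovers `T h`. -/
lemma extendLeft_coactL (T : H →ₗ[k] M) (x : P ⊗[k] P) :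
    extendLeft (coactL δ T) x = actL k P M (T.lTensor P (preCan δ x)) := by
  induction x with
  | zero => simp
  | add x y hx hy => simp only [map_add, hx, hy]
  | tmul r p =>
    rw [extendLeft_tmul, preCan_tmul, coactL, LinearMap.comp_apply, LinearMap.comp_apply,
      AlgHom.toLinearMap_apply]
    generalize δ p = y
    induction y with
    | zero => simp
    | add x y hx hy => simp only [map_add, smul_add, hx, hy]
    | tmul q g => simp [actL, TensorProduct.smul_tmul']

lemma extendLeft_coactL_eq {T : H →ₗ[k] M} {x : P ⊗[k] P} {h : H}
    (hx : preCan δ x = 1 ⊗ₜ[k] h) : extendLeft (coactL δ T) x = T h := by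
  rw [extendLeft_coactL, hx]
  simp [actL]

/-- A linear map `T` on `H` is determined by `p ↦ p₍₀₎ T(p₍₁₎)`. -/
lemma IsHopfGalois.coactL_injective (hδ : IsHopfGalois δ) {T T' : H →ₗ[k] M}
    (h : coactL δ T = coactL δ T') : T = T' := by
  ext g
  obtain ⟨x, hx⟩ := hδ.surjective_preCan (1 ⊗ₜ[k] g)
  rw [← extendLeft_coactL_eq hx, h, extendLeft_coactL_eq hx]

/-- Every left `B`-linear map on `P` has the form `p ↦ p₍₀₎ T(p₍₁₎)`. -/
lemma IsHopfGalois.exists_coactL_eq (hδ : IsHopfGalois δ) (N : P →ₗ[k] M)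
    (hN : ∀ (b : coinv δ) (p : P), N (b * p) = (b : P) • N p) :
    ∃ T : H →ₗ[k] M, coactL δ T = N := by
  -- Left `B`-linearity makes the extension descend to `P ⊗_B P`; injectivity of `χ` then makes it
  -- depend only on `preCan`.
  have hker : ∀ x ∈ balancing δ, extendLeft N x = 0 := by
    intro x hx
    induction hx using Submodule.span_induction with
    | mem x hx =>
      obtain ⟨p, q, b, rfl⟩ := hx
      rw [map_sub, extendLeft_tmul, extendLeft_tmul, hN, mul_smul, sub_self]
    | zero => simp
    | add x y _ _ hx hy => rw [map_add, hx, hy, add_zero]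
    | smul c x _ hx =>
      have := ((extendLeft N).restrictScalars k).map_smul c x
      rw [LinearMap.restrictScalars_apply, LinearMap.restrictScalars_apply, hx, smul_zero] at this
      exact this
  have heq {t t' : P ⊗[k] P} (h : preCan δ t = preCan δ t') : extendLeft N t = extendLeft N t' := by
    rw [← sub_eq_zero, ← map_sub]
    exact hker _ (hδ.sub_mem_balancing h)
  -- Any linear section of `preCan` serves to define `T`; by `heq` the choice does not matter.
  obtain ⟨σ, hσ⟩ := LinearMap.exists_rightInverse_of_surjective (preCan δ)
    (LinearMap.range_eq_top.2 hδ.surjective_preCan)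
  have hσ' (x) : preCan δ (σ x) = x := LinearMap.congr_fun hσ x
  refine ⟨(extendLeft N).restrictScalars k ∘ₗ σ ∘ₗ TensorProduct.mk k P H 1, ?_⟩
  have e : actL k P M ∘ₗ
      ((extendLeft N).restrictScalars k ∘ₗ σ ∘ₗ TensorProduct.mk k P H 1).lTensor P =
      (extendLeft N).restrictScalars k ∘ₗ σ := by
    ext r h
    simp only [actL, TensorProduct.AlgebraTensorModule.curry_apply,
      LinearMap.restrictScalars_self, TensorProduct.curry_apply, LinearMap.comp_apply,
      LinearMap.lTensor_tmul, TensorProduct.lift.tmul, LinearMap.restrictScalars_apply,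
      TensorProduct.mk_apply, AlgHom.toLinearMap_apply, Algebra.lsmul_coe]
    rw [← map_smul]
    apply heq
    rw [preCan_smul, hσ', hσ', TensorProduct.smul_tmul', smul_eq_mul, mul_one]
  ext p
  rw [coactL, ← LinearMap.comp_assoc, e]
  change extendLeft N (σ (δ p)) = N p
  rw [heq (t' := 1 ⊗ₜ[k] p) (by rw [hσ', preCan_tmul, one_smul]), extendLeft_tmul, one_smul]

end coactL

/-! ### Connection forms and splittings -/

lemma coactL_coinv_smul (w : H →ₗ[k] P ⊗[k] P) (b : coinv δ) (p : P) :
    coactL δ w (b * p) = (b : P) • coactL δ w p := by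
  rw [coactL_tensor, smul_eq_inclLeft_mul]
  exact coactMul_coinv_mul (inclLeft k P P).toLinearMap (fun b => inclLeft k P P (b : P))
    (fun b p => by simp) _ b p

lemma incl_coactL (w : H →ₗ[k] Omega k P) :
    Omega.incl k P ∘ₗ coactL δ w = coactL δ (Omega.incl k P ∘ₗ w) :=
  comp_coactL (Omega k P).subtype w

lemma coactL_apply_one (w : H →ₗ[k] P ⊗[k] P) : coactL δ w 1 = w 1 := by
  rw [coactL_tensor, coactMul_apply_one, AlgHom.toLinearMap_apply, map_one, one_mul]

/-- For `w : H → P ⊗ P`, the map `p ↦ p₍₀₎ w(p₍₁₎)` is colinear precisely when `w` intertwines the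
adjoint and the diagonal coactions. -/
lemma IsHopfGalois.intertwines_coactL_iff (hδ : IsHopfGalois δ) (w : H →ₗ[k] P ⊗[k] P) :
    Intertwines δ.toLinearMap (diagCoaction δ) (coactL δ w) ↔
      Intertwines (adCoaction k H) (diagCoaction δ) w := by
  have h1 := diagCoaction_coactL_eq hδ.toIsCoaction w
  have h2 := rTensor_coactL_eq hδ.toIsCoaction w
  have h3 := adColinear_iff (toConv w) (toConv (diagCoaction δ ∘ₗ w))
  unfold Intertwines
  rw [h1, h2]
  refine Iff.trans ⟨fun h => ?_, fun h => congrArg _ h⟩ h3.symm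
  have hi (r : P) (x : (P ⊗[k] P) ⊗[k] H) :
      r • x = (inclLeft k H (P ⊗[k] P)).comp (inclLeft k P P) r * x := by
    induction x with
    | zero => simp
    | add x y hx hy => simp only [smul_add, mul_add, hx, hy]
    | tmul a b => simp [TensorProduct.smul_tmul', smul_eq_inclLeft_mul]
  -- The Galois condition cancels the common factor `(p ⊗ 1) ⊗ 1`, once the target is viewed as a
  -- left `P`-module.
  apply ofConv_injective
  apply hδ.coactL_injective
  rw [coactL_eq _ hi, coactL_eq _ hi]
  exact h

lemma intertwines_incl_form_iff (w : H →ₗ[k] Omega k P) :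
    omegaCoaction δ ∘ₗ w = w.rTensor H ∘ₗ adCoaction k H ↔
      Intertwines (adCoaction k H) (diagCoaction δ) (Omega.incl k P ∘ₗ w) :=
  ⟨fun h => intertwines_incl.comp (σ := omegaCoaction δ) h,
    fun h => intertwines_incl.of_comp incl_injective h⟩

/-- The map `p ↦ p ⊗ 1 + p₍₀₎ ω(p₍₁₎)`. -/
def StrongConnectionForm.splittingAux (w : StrongConnectionForm δ) : P →ₗ[k] P ⊗[k] P :=
  (inclLeft k P P).toLinearMap + Omega.incl k P ∘ₗ coactL δ w.toMap

lemma StrongConnectionForm.splittingAux_apply (w : StrongConnectionForm δ) (p : P) :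
    w.splittingAux p = p ⊗ₜ[k] 1 + (coactL δ w.toMap p : P ⊗[k] P) := rfl

/-- The element equals `1 ⊗ p - (dp - p₍₀₎ ω(p₍₁₎))`, and strongness places the bracket in `(Ω¹B)P`.
-/
lemma StrongConnectionForm.splittingAux_mem (w : StrongConnectionForm δ) (p : P) :
    w.splittingAux p ∈ LinearMap.range (inclB δ) := by
  have h := OmegaBP_le_range (w.strong p)
  have h1 : (1 : P) ⊗ₜ[k] p ∈ LinearMap.range (inclB δ) := ⟨1 ⊗ₜ[k] p, by simp⟩
  have := sub_mem h1 h
  rw [coe_d] at this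
  rw [w.splittingAux_apply]
  convert this using 1
  abel

lemma StrongConnectionForm.inclB_retractB_splittingAux (w : StrongConnectionForm δ) (p : P) :
    inclB δ (retractB δ (w.splittingAux p)) = w.splittingAux p :=
  inclB_retractB (w.splittingAux_mem p)

lemma StrongConnectionForm.splittingAux_mul (w : StrongConnectionForm δ) (b : coinv δ) (p : P) :
    w.splittingAux (b * p) = (b : P) • w.splittingAux p := by
  rw [splittingAux, incl_coactL, LinearMap.add_apply, LinearMap.add_apply, coactL_coinv_smul,
    smul_add]
  simp [TensorProduct.smul_tmul']

/-- The splitting of a connection form as a left `B`-linear map. -/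
def StrongConnectionForm.splittingMap (w : StrongConnectionForm δ) :
    P →ₗ[coinv δ] coinv δ ⊗[k] P where
  toFun p := retractB δ (w.splittingAux p)
  map_add' p q := by rw [map_add, map_add]
  map_smul' b p := by
    apply inclB_injective
    rw [RingHom.id_apply, inclB_smul, w.inclB_retractB_splittingAux,
      w.inclB_retractB_splittingAux, Subalgebra.smul_def, smul_eq_mul, w.splittingAux_mul]

lemma StrongConnectionForm.inclB_splittingMap (w : StrongConnectionForm δ) (p : P) :
    inclB δ (w.splittingMap p) = w.splittingAux p := w.inclB_retractB_splittingAux p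

lemma StrongConnectionForm.inclB_comp_splittingMap (w : StrongConnectionForm δ) :
    inclB δ ∘ₗ w.splittingMap.restrictScalars k = w.splittingAux :=
  LinearMap.ext w.inclB_splittingMap

lemma StrongConnectionForm.intertwines_splittingAux (hδ : IsHopfGalois δ)
    (w : StrongConnectionForm δ) :
    Intertwines δ.toLinearMap (diagCoaction δ) w.splittingAux := by
  refine Intertwines.add diagCoaction_comp_inclLeft ?_
  rw [incl_coactL]
  exact (hδ.intertwines_coactL_iff _).2 ((intertwines_incl_form_iff _).1 w.colinear)

/-- The splitting of a connection form. -/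
def StrongConnectionForm.toSplitting (hδ : IsHopfGalois δ) (w : StrongConnectionForm δ) :
    StrongSplitting δ where
  toMap := w.splittingMap
  map_one := by
    apply inclB_injective
    rw [w.inclB_splittingMap, splittingAux, incl_coactL, LinearMap.add_apply, coactL_apply_one]
    simp [w.map_one]
  splits p := by
    have : LinearMap.mul' k P (coactL δ w.toMap p : P ⊗[k] P) = 0 := (coactL δ w.toMap p).2
    rw [← mul_inclB, w.inclB_splittingMap, w.splittingAux_apply, map_add, this]
    simp
  colinear := by
    refine intertwines_inclB.of_comp inclB_injective ?_
    rw [w.inclB_comp_splittingMap]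
    exact w.intertwines_splittingAux hδ

/-- The connection form of a splitting as a linear map. -/
def StrongSplitting.formMap (hδ : IsHopfGalois δ) (s : StrongSplitting δ) : H →ₗ[k] Omega k P :=
  (hδ.exists_coactL_eq s.toDifferential.vert s.toDifferential.vert_mul).choose

lemma StrongSplitting.coactL_formMap (hδ : IsHopfGalois δ) (s : StrongSplitting δ) :
    coactL δ (s.formMap hδ) = s.toDifferential.vert :=
  (hδ.exists_coactL_eq s.toDifferential.vert s.toDifferential.vert_mul).choose_spec

lemma StrongSplitting.coe_vert (s : StrongSplitting δ) (p : P) :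
    (s.toDifferential.vert p : P ⊗[k] P) = inclB δ (s.toMap p) - p ⊗ₜ[k] 1 := by
  have : s.toDifferential.toMap p = 1 ⊗ₜ[k] p - s.toMap p := rfl
  rw [CovariantDifferential.coe_vert, this, coe_d, map_sub, inclB_tmul]
  simp only [OneMemClass.coe_one]
  abel

/-- By `IsHopfGalois.coactL_injective` it suffices to compare on `P`. There `preCan` sends `s(p) - p
⊗ 1` to `δ p - p ⊗ 1`, because `s` splits multiplication, and this is the map on `P` induced by `j -
1`. -/
lemma StrongSplitting.preCan_formMap (hδ : IsHopfGalois δ) (s : StrongSplitting δ) (h : H) :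
    preCan δ (s.formMap hδ h : P ⊗[k] P) = 1 ⊗ₜ[k] (h - algebraMap k H (Coalgebra.counit h)) := by
  let c : P ⊗[k] P →ₗ[P] P ⊗[k] H :=
    { toFun := preCan δ
      map_add' := fun x y => map_add _ x y
      map_smul' := preCan_smul }
  have h1 : coactL δ (preCan δ ∘ₗ Omega.incl k P ∘ₗ s.formMap hδ) =
      preCan δ ∘ₗ Omega.incl k P ∘ₗ s.toDifferential.vert := by
    rw [← s.coactL_formMap hδ, incl_coactL]
    exact (comp_coactL c _).symm
  have h2 : preCan δ ∘ₗ Omega.incl k P ∘ₗ s.toDifferential.vert =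
      δ.toLinearMap - (inclLeft k H P).toLinearMap := by
    ext p
    change preCan δ (s.toDifferential.vert p : P ⊗[k] P) = δ p - p ⊗ₜ[k] 1
    rw [s.coe_vert, map_sub, preCan_inclB, s.splits, preCan_tmul, _root_.map_one,
      smul_eq_inclLeft_mul, mul_one]
    rfl
  have h3 : coactL δ ((convIncl k H P).val - 1).ofConv =
      δ.toLinearMap - (inclLeft k H P).toLinearMap := by
    rw [coactL_tensor, toConv_ofConv, coactMul_sub_right, coactMul_one hδ.toIsCoaction,
      ← coaction_eq_coactMul]
  have := hδ.coactL_injective (h1.trans (h2.trans h3.symm))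
  have e : (convIncl k H P).val.ofConv h - (1 : WithConv (H →ₗ[k] P ⊗[k] H)).ofConv h =
      1 ⊗ₜ[k] (h - algebraMap k H (Coalgebra.counit h)) := by
    change (1 : P) ⊗ₜ[k] h - algebraMap k (P ⊗[k] H) (Coalgebra.counit h) = _
    rw [TensorProduct.tmul_sub, Algebra.algebraMap_eq_smul_one, Algebra.algebraMap_eq_smul_one,
      TensorProduct.tmul_smul]
    rfl
  exact (LinearMap.congr_fun this h).trans e

/-- The connection form of a splitting. -/
def StrongSplitting.toForm (hδ : IsHopfGalois δ) (s : StrongSplitting δ) :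
    StrongConnectionForm δ where
  toMap := s.formMap hδ
  map_one := by
    rw [← extendLeft_coactL_eq (δ := δ) (x := 1 ⊗ₜ[k] 1) (h := 1), extendLeft_tmul,
      s.coactL_formMap, CovariantDifferential.vert_one, smul_zero]
    rw [preCan_tmul, _root_.map_one, one_smul]
    rfl
  colinear := by
    rw [intertwines_incl_form_iff, ← hδ.intertwines_coactL_iff, ← incl_coactL, s.coactL_formMap]
    exact intertwines_incl.comp s.toDifferential.intertwines_vert
  vertical := s.preCan_formMap hδ
  strong p := by
    rw [s.coactL_formMap, CovariantDifferential.coe_vert, sub_sub_cancel]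
    exact ⟨_, s.toDifferential.mem p, rfl⟩

/-- Connection forms and splittings correspond by `s(p) = p ⊗ 1 + p₍₀₎ ω(p₍₁₎)`. -/
def formEquivSplitting (hδ : IsHopfGalois δ) : StrongConnectionForm δ ≃ StrongSplitting δ where
  toFun w := w.toSplitting hδ
  invFun s := s.toForm hδ
  left_inv w := by
    apply StrongConnectionForm.ext
    apply hδ.coactL_injective
    refine (StrongSplitting.coactL_formMap hδ _).trans ?_
    ext p
    rw [StrongSplitting.coe_vert]
    change inclB δ (w.splittingMap p) - _ = _
    rw [w.inclB_splittingMap, w.splittingAux_apply, add_sub_cancel_left]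
  right_inv s := by
    apply StrongSplitting.ext
    ext p
    apply inclB_injective
    change inclB δ ((s.toForm hδ).splittingMap p) = _
    rw [StrongConnectionForm.inclB_splittingMap, StrongConnectionForm.splittingAux_apply]
    change _ + (coactL δ (s.formMap hδ) p : P ⊗[k] P) = _
    rw [s.coactL_formMap, s.coe_vert, add_sub_cancel]

/-- Connections and connection forms correspond by `ω(h) = h⁽¹⁾ Π(dh⁽²⁾)`. -/
def connectionEquivForm (hδ : IsHopfGalois δ) : StrongConnection δ ≃ StrongConnectionForm δ :=
  ((splittingEquivDifferential δ).trans (differentialEquivConnection δ)).symm.trans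
    (formEquivSplitting hδ).symm

/-- This relation determines the form. Extending it left linearly and evaluating on a lift of `τ(h)`
gives `ω(h) = h⁽¹⁾ Π(dh⁽²⁾)`. -/
lemma coactL_connectionEquivForm (hδ : IsHopfGalois δ) (Q : StrongConnection δ) :
    coactL δ (connectionEquivForm hδ Q).toMap = Q.toMap.restrictScalars k ∘ₗ d k := by
  obtain ⟨D, rfl⟩ := (differentialEquivConnection δ).surjective Q
  obtain ⟨s, rfl⟩ := (splittingEquivDifferential δ).surjective D
  have : connectionEquivForm hδ (differentialEquivConnection δ (splittingEquivDifferential δ s)) =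
      s.toForm hδ := by
    simp only [connectionEquivForm, Equiv.trans_apply, Equiv.symm_trans_apply,
      Equiv.symm_apply_apply]
    rfl
  rw [this]
  refine (s.coactL_formMap hδ).trans (LinearMap.ext fun p => ?_)
  exact (s.toDifferential.toConnection_d p).symm

/-! ### Gauge transformations of splittings -/

lemma mulB_mul_inclRight (x : coinv δ ⊗[k] P) (q : P) :
    mulB δ (x * inclRight k (coinv δ) P q) = mulB δ x * q := by
  induction x with
  | zero => simp
  | add x y hx hy => simp only [map_add, add_mul, hx, hy]
  | tmul b p => simp [mul_assoc]

/-- Multiplication `B ⊗ P → P` need not be an algebra homomorphism, so right `P`-linearity takes the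
place of `comp_coactMul`. -/
lemma mulB_comp_coactMul (N : P →ₗ[k] coinv δ ⊗[k] P) (g : WithConv (H →ₗ[k] P)) :
    mulB δ ∘ₗ coactMul δ N (convMap H (inclRight k (coinv δ) P) g) =
      coactMul δ (mulB δ ∘ₗ N) g := by
  have e : mulB δ ∘ₗ LinearMap.mul' k _ ∘ₗ
      TensorProduct.map N (convMap H (inclRight k (coinv δ) P) g).ofConv =
      LinearMap.mul' k P ∘ₗ TensorProduct.map (mulB δ ∘ₗ N) g.ofConv := by
    ext p h
    exact mulB_mul_inclRight (N p) (g.ofConv h)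
  exact congrArg (· ∘ₗ δ.toLinearMap) e

lemma StrongSplitting.mulB_comp (s : StrongSplitting δ) :
    mulB δ ∘ₗ s.toMap.restrictScalars k = LinearMap.id :=
  LinearMap.ext s.splits

lemma StrongSplitting.gaugeTwist_mul_coinv (f : (WithConv (H →ₗ[k] P))ˣ) (s : StrongSplitting δ)
    (b : coinv δ) (p : P) : gaugeTwist δ f (s.toMap.restrictScalars k) (b * p) =
      b • gaugeTwist δ f (s.toMap.restrictScalars k) p := by
  rw [gaugeTwist_eq, smul_eq_inclLeft_mul (P := coinv δ)]
  refine coactMul_coinv_mul _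
    (inclLeft k P (coinv δ)) ?_ _ b p
  intro b p
  rw [← smul_eq_inclLeft_mul, LinearMap.comp_apply, coactL_coinv_mul]
  exact s.toMap.map_smul b _

lemma StrongSplitting.mulB_gaugeTwist (hδ : IsCoaction δ) (f : (WithConv (H →ₗ[k] P))ˣ)
    (s : StrongSplitting δ) (p : P) :
    mulB δ (gaugeTwist δ f (s.toMap.restrictScalars k) p) = p := by
  have : mulB δ ∘ₗ gaugeTwist δ f (s.toMap.restrictScalars k) = LinearMap.id := by
    rw [gaugeTwist_eq, mulB_comp_coactMul, ← LinearMap.comp_assoc, s.mulB_comp]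
    exact coactMul_gauge_inv hδ f (AlgHom.id k P)
  exact LinearMap.congr_fun this p

lemma StrongSplitting.gaugeTwist_apply_one {f : (WithConv (H →ₗ[k] P))ˣ} (hf : IsGauge δ f)
    (s : StrongSplitting δ) : gaugeTwist δ f (s.toMap.restrictScalars k) 1 = 1 ⊗ₜ 1 := by
  have hinv : f.inv.ofConv 1 = 1 := hf.inv.map_one
  have e : (convMap H (inclRight k (coinv δ) P) f.inv).ofConv 1 = 1 := by
    rw [ofConv_convMap, LinearMap.comp_apply, hinv, AlgHom.toLinearMap_apply, _root_.map_one]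
  rw [gaugeTwist_eq, coactMul_apply_one, e, mul_one, LinearMap.comp_apply, coactL_one_apply,
    hf.map_one]
  exact s.map_one

/-- The gauge transform of a splitting. -/
def StrongSplitting.gauge (hδ : IsCoaction δ) {f : (WithConv (H →ₗ[k] P))ˣ} (hf : IsGauge δ f)
    (s : StrongSplitting δ) : StrongSplitting δ where
  toMap :=
    { toFun := gaugeTwist δ f (s.toMap.restrictScalars k)
      map_add' := fun p q => map_add _ p q
      map_smul' := s.gaugeTwist_mul_coinv f }
  map_one := s.gaugeTwist_apply_one hf
  splits := s.mulB_gaugeTwist hδ f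
  colinear := by
    have h := s.colinear
    rw [coactionB_eq] at h ⊢
    exact colinear_gaugeTwist hδ hf h

lemma StrongSplitting.ext_restrictScalars {s t : StrongSplitting δ}
    (h : s.toMap.restrictScalars k = t.toMap.restrictScalars k) : s = t :=
  StrongSplitting.ext (LinearMap.ext fun p => (LinearMap.congr_fun h p :))

/-- The left action of the gauge group on splittings. -/
abbrev splittingAction (hδ : IsCoaction δ) : MulAction (gaugeGroup δ) (StrongSplitting δ) where
  smul f s := s.gauge hδ f.2
  one_smul s := StrongSplitting.ext_restrictScalars
    (gaugeTwist_one hδ (s.toMap.restrictScalars k))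
  mul_smul f g s := StrongSplitting.ext_restrictScalars
    (gaugeTwist_mul (g := g.1) hδ f.2 (s.toMap.restrictScalars k))

/-! ### Gauge transformations of differentials, connections and forms -/

lemma gaugeTwist_toDifferential (hδ : IsCoaction δ) {f : (WithConv (H →ₗ[k] P))ˣ}
    (hf : IsGauge δ f) (s : StrongSplitting δ) :
    (s.gauge hδ hf).toDifferential.toMap = gaugeTwist δ f s.toDifferential.toMap := by
  have e : s.toDifferential.toMap =
      (inclRight k (coinv δ) P).toLinearMap - s.toMap.restrictScalars k := rfl
  rw [e, gaugeTwist_sub, gaugeTwist_inclRight hδ]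
  rfl

lemma inclB_comp_gaugeTwist (f : (WithConv (H →ₗ[k] P))ˣ) (T : P →ₗ[k] coinv δ ⊗[k] P) :
    inclB δ ∘ₗ gaugeTwist δ f T = gaugeTwist δ f (inclB δ ∘ₗ T) := by
  let i : coinv δ ⊗[k] P →ₐ[k] P ⊗[k] P :=
    Algebra.TensorProduct.map (coinv δ).val (AlgHom.id k P)
  have hi : inclB δ = i.toLinearMap := by
    ext b p
    simp [i]
  have hi' : i.comp (inclRight k (coinv δ) P) = inclRight k P P := by
    ext p
    simp [i]
  rw [gaugeTwist_eq, gaugeTwist_eq, hi, comp_coactMul, ← convMap_comp, hi']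
  rfl

lemma inhomogeneous_eq (f : (WithConv (H →ₗ[k] P))ˣ) :
    actL k P (P ⊗[k] P) ∘ₗ
      TensorProduct.map (coactL δ f.val.ofConv) (Omega.incl k P ∘ₗ d k ∘ₗ f.inv.ofConv) ∘ₗ
      δ.toLinearMap =
    coactMul δ ((inclLeft k P P).toLinearMap ∘ₗ coactL δ f.val.ofConv)
      (convMap H (inclRight k P P) f.inv - convMap H (inclLeft k P P) f.inv) := by
  have e : actL k P (P ⊗[k] P) ∘ₗ
      TensorProduct.map (coactL δ f.val.ofConv) (Omega.incl k P ∘ₗ d k ∘ₗ f.inv.ofConv) =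
      LinearMap.mul' k _ ∘ₗ TensorProduct.map ((inclLeft k P P).toLinearMap ∘ₗ
        coactL δ f.val.ofConv)
        (convMap H (inclRight k P P) f.inv - convMap H (inclLeft k P P) f.inv).ofConv := by
    rw [← LinearMap.comp_assoc _ (d k), incl_comp_d]
    ext p h
    simp [actL, smul_eq_inclLeft_mul]
  exact congrArg (· ∘ₗ δ.toLinearMap) e

/-- Twist `1 ⊗ p - p ⊗ 1 - Dp`: the first term is fixed, and the second becomes `-p₍₀₎ f(p₍₁₎) ⊗
f⁻¹(p₍₂₎)`. The inhomogeneous term is `p₍₀₎ f(p₍₁₎) ⊗ f⁻¹(p₍₂₎) - p ⊗ 1`, which restores `-p ⊗ 1`.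
-/
lemma gaugeConnection_toConnection (hδ : IsCoaction δ) (f : (WithConv (H →ₗ[k] P))ˣ)
    (D : CovariantDifferential δ) :
    gaugeConnection δ f D.toConnection.toMap =
      Omega.incl k P ∘ₗ d k - inclB δ ∘ₗ gaugeTwist δ f D.toMap := by
  have e : Omega.incl k P ∘ₗ D.toConnection.toMap.restrictScalars k ∘ₗ d k =
      (inclRight k P P).toLinearMap - (inclLeft k P P).toLinearMap - inclB δ ∘ₗ D.toMap := by
    rw [← incl_comp_d, ← D.incl_comp_vert]
    exact congrArg _ (LinearMap.ext D.toConnection_d)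
  rw [gaugeConnection, e, inhomogeneous_eq, gaugeTwist_sub, gaugeTwist_sub,
    gaugeTwist_inclRight hδ, coactMul_sub_right, coactMul_gauge_inv hδ, inclB_comp_gaugeTwist,
    incl_comp_d, gaugeTwist_eq f (inclLeft k P P).toLinearMap]
  abel

lemma gaugeForm_eq (f : (WithConv (H →ₗ[k] P))ˣ) (w : H →ₗ[k] Omega k P) :
    toConv (gaugeForm f w) = convMap H (inclLeft k P P) f.val *
        (toConv (Omega.incl k P ∘ₗ w) * convMap H (inclRight k P P) f.inv) +
      convMap H (inclLeft k P P) f.val *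
        (convMap H (inclRight k P P) f.inv - convMap H (inclLeft k P P) f.inv) := by
  have e (T : H →ₗ[k] P ⊗[k] P) : actL k P (P ⊗[k] P) ∘ₗ TensorProduct.map f.val.ofConv T =
      LinearMap.mul' k _ ∘ₗ TensorProduct.map (convMap H (inclLeft k P P) f.val).ofConv T := by
    ext g h
    simp [actL, smul_eq_inclLeft_mul]
  have e' : actR k P P ∘ₗ TensorProduct.map (Omega.incl k P ∘ₗ w) f.inv.ofConv =
      LinearMap.mul' k _ ∘ₗ TensorProduct.map (Omega.incl k P ∘ₗ w)
        (convMap H (inclRight k P P) f.inv).ofConv := by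
    ext g h
    simp only [actR, TensorProduct.AlgebraTensorModule.curry_apply,
      LinearMap.restrictScalars_self, TensorProduct.curry_apply, LinearMap.comp_apply,
      TensorProduct.map_tmul]
    generalize Omega.incl k P (w g) = x
    induction x with
    | zero => simp
    | add x y hx hy => simp only [map_add, TensorProduct.add_tmul, hx, hy]
    | tmul a b => simp
  have e'' : Omega.incl k P ∘ₗ d k ∘ₗ f.inv.ofConv =
      (convMap H (inclRight k P P) f.inv - convMap H (inclLeft k P P) f.inv).ofConv := by
    rw [← LinearMap.comp_assoc, incl_comp_d, LinearMap.sub_comp]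
    rfl
  rw [gaugeForm, e'', ← LinearMap.comp_assoc _ _ (actR k P P), e', ← LinearMap.comp_assoc,
    ← LinearMap.comp_assoc, e, e]
  rfl

/-- The leading factor `f` is absorbed as `p₍₀₎ f(p₍₁₎) = F_f(p)`. Colinearity of `F_f` then
identifies `F_f * ω` with `(id * ω) ∘ F_f = Π ∘ d ∘ F_f`. -/
lemma coactL_gaugeForm (hδ : IsCoaction δ) {f : (WithConv (H →ₗ[k] P))ˣ} (hf : IsGauge δ f)
    (w : H →ₗ[k] Omega k P) (Q : Omega k P →ₗ[P] Omega k P)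
    (hw : coactL δ w = Q.restrictScalars k ∘ₗ d k) :
    coactL δ (gaugeForm f w) = gaugeConnection δ f Q := by
  have e : coactMul δ (inclLeft k P P).toLinearMap (convMap H (inclLeft k P P) f.val) =
      (inclLeft k P P).toLinearMap ∘ₗ coactL δ f.val.ofConv := by
    rw [coactL_self, comp_coactMul]
    rfl
  rw [gaugeConnection, inhomogeneous_eq, ← hw, incl_coactL, coactL_tensor (gaugeForm f w),
    gaugeForm_eq, coactMul_add_right, ← coactMul_coactMul hδ, ← coactMul_coactMul hδ, e,
    ← coactMul_coactMul hδ, coactL_tensor (Omega.incl k P ∘ₗ w), gaugeTwist_eq,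
    coactMul_comp _ (hf.colinear_coactL hδ), e]

lemma gaugeForm_connectionEquivForm (hδ : IsHopfGalois δ) {f : (WithConv (H →ₗ[k] P))ˣ}
    (hf : IsGauge δ f) {Q Q' : StrongConnection δ}
    (h : Omega.incl k P ∘ₗ Q'.toMap.restrictScalars k ∘ₗ d k = gaugeConnection δ f Q.toMap) :
    Omega.incl k P ∘ₗ (connectionEquivForm hδ Q').toMap =
      gaugeForm f (connectionEquivForm hδ Q).toMap := by
  apply hδ.coactL_injective
  rw [coactL_gaugeForm hδ.toIsCoaction hf _ _ (coactL_connectionEquivForm hδ Q), ← h,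
    ← incl_coactL, coactL_connectionEquivForm]

end HopfGalois

end

/-! ### The main theorem -/

open HopfGalois in
theorem theorem4p1 {k H P : Type*} [Field k] [Ring H] [HopfAlgebra k H] [Ring P] [Algebra k P]
    (δ : P →ₐ[k] P ⊗[k] H) (hδ : IsHopfGalois δ) (hne : Nonempty (StrongConnection δ)) :
    -- the identifications of the four descriptions
    ∃ (J₁ : StrongSplitting δ ≃ CovariantDifferential δ)
      (J₂ : CovariantDifferential δ ≃ StrongConnection δ)
      (J₃ : StrongConnection δ ≃ StrongConnectionForm δ)
      (J₄ : StrongConnectionForm δ ≃ StrongSplitting δ),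
      (∀ s (p : P), (J₁ s).toMap p = 1 ⊗ₜ[k] p - s.toMap p) ∧
      (∀ D (r p : P), ((J₂ D).toMap (r • d k p) : P ⊗[k] P) = r • (d k p - inclB δ (D.toMap p))) ∧
      (∀ Q h (t : P ⊗[k] P), (balancing δ).mkQ t = translation hδ h →
        (J₃ Q).toMap h =
          actL k P (Omega k P) ((Q.toMap.restrictScalars k ∘ₗ d k).lTensor P t)) ∧
      (∀ w (p : P), inclB δ ((J₄ w).toMap p) = p ⊗ₜ[k] 1 + (coactL δ w.toMap p : P ⊗[k] P)) ∧
      (∀ s, J₄ (J₃ (J₂ (J₁ s))) = s) ∧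
      -- gauge transformations form a group under convolution
      ∃ G : Subgroup (WithConv (H →ₗ[k] P))ˣ, (∀ f, f ∈ G ↔ IsGauge δ f) ∧
      -- which acts from the left on each of the four sets
      ∃ (_ : MulAction G (StrongSplitting δ)) (_ : MulAction G (CovariantDifferential δ))
        (_ : MulAction G (StrongConnection δ)) (_ : MulAction G (StrongConnectionForm δ)),
        (∀ (f : G) (s : StrongSplitting δ) p,
          (f • s).toMap p = gaugeTwist δ f (s.toMap.restrictScalars k) p) ∧
        (∀ (f : G) (D : CovariantDifferential δ) p,
          (f • D).toMap p = gaugeTwist δ f D.toMap p) ∧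
        (∀ (f : G) (Q : StrongConnection δ) (r p : P),
          ((f • Q).toMap (r • d k p) : P ⊗[k] P) = r • gaugeConnection δ f Q.toMap p) ∧
        (∀ (f : G) (w : StrongConnectionForm δ) h,
          ((f • w).toMap h : P ⊗[k] P) = gaugeForm f w.toMap h) ∧
        -- compatibly with the identifications
        (∀ (f : G) (s : StrongSplitting δ), J₁ (f • s) = f • J₁ s) ∧
        (∀ (f : G) (D : CovariantDifferential δ), J₂ (f • D) = f • J₂ D) ∧
        (∀ (f : G) (Q : StrongConnection δ), J₃ (f • Q) = f • J₃ Q) ∧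
        (∀ (f : G) (w : StrongConnectionForm δ), J₄ (f • w) = f • J₄ w) := by
  have hJ₄ (s : StrongSplitting δ) : formEquivSplitting hδ (connectionEquivForm hδ
      (differentialEquivConnection δ (splittingEquivDifferential δ s))) = s := by
    simp [connectionEquivForm]
  let a₁ := splittingAction hδ.toIsCoaction
  -- Each further action is transported along a bijection from the preceding description, so
  -- compatibility with the first three bijections only needs the inverse to cancel.
  let a₂ := (splittingEquivDifferential δ).symm.mulAction (gaugeGroup δ)
  let a₃ := (differentialEquivConnection δ).symm.mulAction (gaugeGroup δ)
  let a₄ := (connectionEquivForm hδ).symm.mulAction (gaugeGroup δ)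
  have c₁ (f : gaugeGroup δ) (s : StrongSplitting δ) :
      splittingEquivDifferential δ (f • s) = f • splittingEquivDifferential δ s :=
    congrArg (fun t => splittingEquivDifferential δ (f • t)) (Equiv.symm_apply_apply _ s).symm
  have c₂ (f : gaugeGroup δ) (D : CovariantDifferential δ) :
      differentialEquivConnection δ (f • D) = f • differentialEquivConnection δ D :=
    congrArg (fun t => differentialEquivConnection δ (f • t)) (Equiv.symm_apply_apply _ D).symm
  have c₃ (f : gaugeGroup δ) (Q : StrongConnection δ) :
      connectionEquivForm hδ (f • Q) = f • connectionEquivForm hδ Q :=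
    congrArg (fun t => connectionEquivForm hδ (f • t)) (Equiv.symm_apply_apply _ Q).symm
  have hD (f : gaugeGroup δ) (D : CovariantDifferential δ) :
      (f • D).toMap = gaugeTwist δ f D.toMap := by
    obtain ⟨s, rfl⟩ := (splittingEquivDifferential δ).surjective D
    rw [← c₁]
    exact gaugeTwist_toDifferential hδ.toIsCoaction f.2 s
  have hQ (f : gaugeGroup δ) (Q : StrongConnection δ) :
      Omega.incl k P ∘ₗ (f • Q).toMap.restrictScalars k ∘ₗ d k =
        gaugeConnection δ f Q.toMap := by
    obtain ⟨D, rfl⟩ := (differentialEquivConnection δ).surjective Q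
    rw [← c₂]
    refine Eq.trans ?_ (gaugeConnection_toConnection hδ.toIsCoaction f.1 D).symm
    rw [← hD, ← CovariantDifferential.incl_comp_vert]
    exact congrArg _ (LinearMap.ext (f • D).toConnection_d)
  refine ⟨splittingEquivDifferential δ, differentialEquivConnection δ, connectionEquivForm hδ,
    formEquivSplitting hδ, splittingEquivDifferential_apply, ?_, ?_, ?_, hJ₄,
    gaugeGroup δ, fun f => Iff.rfl, a₁, a₂, a₃, a₄, fun _ _ _ => rfl, ?_, ?_, ?_, c₁, c₂, c₃, ?_⟩
  · intro D r p
    rw [map_smul, Submodule.coe_smul, ← D.coe_vert]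
    exact congrArg (fun x : Omega k P => r • (x : P ⊗[k] P)) (D.toConnection_d p)
  · intro Q h t ht
    rw [← extendLeft_coactL_eq (preCan_eq_of_mkQ_eq hδ ht), coactL_connectionEquivForm]
    rfl
  · exact fun w p => w.inclB_splittingMap p
  · exact fun f D p => LinearMap.congr_fun (hD f D) p
  · intro f Q r p
    rw [map_smul, Submodule.coe_smul, ← hQ]
    rfl
  · intro f w h
    obtain ⟨Q, rfl⟩ := (connectionEquivForm hδ).surjective w
    rw [← c₃]
    exact LinearMap.congr_fun (gaugeForm_connectionEquivForm hδ f.2 (hQ f Q)) h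
  · intro f w
    obtain ⟨Q, rfl⟩ := (connectionEquivForm hδ).surjective w
    obtain ⟨D, rfl⟩ := (differentialEquivConnection δ).surjective Q
    obtain ⟨s, rfl⟩ := (splittingEquivDifferential δ).surjective D
    -- Compatibility of the last bijection follows from the other three because the cyclic composite
    -- is the identity.
    rw [← c₃, ← c₂, ← c₁, hJ₄, hJ₄]
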